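/- Let $R>2$, let $L_1=\{w-1+(w-1)^{-1}:|w|=R\}$ (an analytic Jordan curve), let $G_1$ be the interior of $L_1$, and put $$\psi(w)=Rw-1+\frac1{Rw-1},\qquad \rho=\frac2R,\qquad \mu=\frac{R-\sqrt{R^2-4}}2\in(0,1),\qquad \lambda(z)=\frac{z-\mu}{\mu z-1}.$$ Let $\varphi$ be a conformal map of $G_1$ onto the unit disk $\{|z|<1\}$. Then $\varphi$ has a meromorphic univalent continuation (again denoted by $\varphi$) to $G_{1/\rho}=\mathbb C\setminus\overline{\psi(\{|w|>1/\rho\})}$, a set that contains $G_1$ and $\psi(\{\rho<|w|<1/\rho\})$, and the following holds. (Meromorphic functions take values in $\overline{\mathbb C}=\mathbb C\cup\{\infty\}$, and $1/\overline{0}=\infty$, $1/\overline{\infty}=0$.) (a) The function $\varphi(\psi(w))$, originally defined on $\rho<|w|<1/\rho$, admits a meromorphic continuation $h_\varphi$ to $\mathbb C\setminus\{\mu,1/\mu\}$. Moreover, $\mu$ and $1/\mu$ are both non-isolated singularities of $h_\varphi$ of "essential type", in the sense that in every punctured neighborhood of either one of these two points $h_\varphi$ attains every value of $\overline{\mathbb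 C}$. (b) $h_\varphi\circ\lambda$ (extended continuously to the pole $t=1/\mu$ of $\lambda$) is meromorphic in $\mathbb C\setminus\{0\}$, and for all $k\in\mathbb Z\setminus\{0\}$ and all $t$ with $\mu^{2k+2}\le|t|\le\mu^{2k}$, $$(h_\varphi\circ\lambda)(t)=\begin{cases}\dfrac1{\overline{(h_\varphi\circ\lambda)(\overline t/\mu^{2k})}},& k\text{ odd},\\[2mm](h_\varphi\circ\lambda)(t/\mu^{2k}),& k\text{ even}.\end{cases}$$ (c) For every $t_0$ with $\mu^2<|t_0|<1$, the solutions of $(h_\varphi\circ\lambda)(t)=(h_\varphi\circ\lambda)(t_0)$ in $0<|t|<1$ are exactly the elements of the two sequences $\{\mu^{4k}t_0\}_{k=0}^\infty$ and $\{\mu^{4k+2}/t_0\}_{k=0}^\infty$. Moreover, $$(h_\varphi\circ\lambda)'(\mu^{4k}t_0)=-\frac{\varphi'(\psi(\lambda(t_0)))\,(1-\mu^4)^2\,(t_0-\mu^2/t_0)}{\mu^{4k+1}\,t_0\,(1-\mu t_0)^2\,(1-\mu^3/t_0)^2},\qquad k\ge0,$$ and if $\mu<|\lambda(t_0)|<1$,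 then $|\lambda(t_0)|>|\lambda(\mu^{4k}t_0)|$ for every $k\ge1$. -/

import Mathlib

open scoped Topology ComplexConjugate

/-- A map `f` into the Riemann sphere `OnePoint ℂ` is meromorphic at `z`: in a punctured
neighbourhood of `z` it is finite and given by a meromorphic function, and its value at `z` is the
limit in the sphere (`∞` at a pole). -/
def SphereMeromorphicAt (f : ℂ → OnePoint ℂ) (z : ℂ) : Prop :=
  (∃ g : ℂ → ℂ, MeromorphicAt g z ∧ ∀ᶠ w in 𝓝[≠] z, f w = (g w : OnePoint ℂ)) ∧
    ContinuousAt f z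

def SphereMeromorphicOn (f : ℂ → OnePoint ℂ) (U : Set ℂ) : Prop :=
  ∀ z ∈ U, SphereMeromorphicAt f z

/-- `f` is finite near `z`, and has complex derivative `d` at `z`. -/
def SphereHasDerivAt (f : ℂ → OnePoint ℂ) (d z : ℂ) : Prop :=
  ∃ g : ℂ → ℂ, (∀ᶠ w in 𝓝 z, f w = (g w : OnePoint ℂ)) ∧ HasDerivAt g d z

/-- The reflection `z ↦ 1 / conj z` of the Riemann sphere about the unit circle. -/
noncomputable def sphereReflect (p : OnePoint ℂ) : OnePoint ℂ :=
  p.elim ((0 : ℂ) : OnePoint ℂ)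
    (fun z => if z = 0 then OnePoint.infty else ((1 / conj z : ℂ) : OnePoint ℂ))

/-- `φ` is a conformal map of the open set `U` onto `V`. -/
def ConformalOnto (φ : ℂ → ℂ) (U V : Set ℂ) : Prop :=
  DifferentiableOn ℂ φ U ∧ Set.BijOn φ U V

/-- The interior of a closed curve: the union of the bounded components of its complement. -/
def curveInterior (L : Set ℂ) : Set ℂ :=
  {z | z ∉ L ∧ Bornology.IsBounded (connectedComponentIn Lᶜ z)}

/-- The curve `L₁`. -/
def curveL (R : ℝ) : Set ℂ :=
  (fun w : ℂ => w - 1 + (w - 1)⁻¹) '' Metric.sphere 0 R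

/-- The domain `G₁` bounded by `L₁`. -/
def domainG (R : ℝ) : Set ℂ := curveInterior (curveL R)

/-- The exterior conformal map `ψ` of `L₁`. -/
noncomputable def psiMap (R : ℝ) (w : ℂ) : ℂ := (R : ℂ) * w - 1 + 1 / ((R : ℂ) * w - 1)

/-- The number `ρ`. -/
noncomputable def rhoNum (R : ℝ) : ℝ := 2 / R

/-- `G_r = ℂ ∖ closure (ψ {|w| > r})`, for `r ≥ ρ`. -/
def levelG (R r : ℝ) : Set ℂ := (closure (psiMap R '' {w : ℂ | r < ‖w‖}))ᶜ

/-- The number `μ`. -/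
noncomputable def muNum (R : ℝ) : ℝ := (R - Real.sqrt (R ^ 2 - 4)) / 2

/-- The Möbius transformation `λ`. -/
noncomputable def lambdaMap (μ : ℝ) (z : ℂ) : ℂ := (z - μ) / (μ * z - 1)

/-! With w = λ(t), ψ becomes u + 1/u for u = Rλ(t) - 1 (`joukParam`), and t ↦ μ²/t acts as u ↦ 1/u.
Hence ψ ∘ λ maps the annulus A = {μ² < |t| < 1} onto G₁ with fibres {t, μ²/t}, branched at ±μ, and
sends both boundary circles into L₁ (`psiMap_lambdaMap_eq_iff`, `domainG_eq`).

The continuation is written down explicitly instead of by iterated Schwarz reflection. Let a =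
φ(ψ(λ(μ))). After a disc automorphism taking a to 0, φ ∘ ψ ∘ λ has a single, double zero in A, at μ,
and its modulus tends to 1 at the boundary. The theta quotient `thetaNum ^ 2 / (t * thetaDen ^ 2)`
has the same zero, the same invariance under t ↦ μ²/t and the same boundary modulus. The maximum
principle for the ratio and for its inverse makes the ratio a unimodular constant
(`exists_eq_thetaQuot`). Solving for φ gives a function H meromorphic on ℂ ∖ {0} with H(μ²/t) = H(t)
and H(1/conj t) = 1/conj H(t) (`exists_isAnnulusExtension`).

These two symmetries carry the rest. Their composite is H(μ² conj t) = 1/conj H(t), whose iterate is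
the period μ⁴; this is (b). H sends A onto the disc with fibres {t, μ²/t}, the unit circle into
itself, and 1 < |t| < μ⁻² into the reflected disc. So preimages are controlled in one fundamental
annulus and repeat by powers of μ⁴ (`solutions`), and every value recurs near 0 and ∞, which λ
carries to μ and 1/μ (`exists_mem_nhds`). The continuation of φ is H pushed down along ψ ∘ λ
(`descend`); it is univalent because disc, circle and exterior values come from |t| < 1, |t| = 1 and
|t| > 1 separately. -/

/-! ### Infinite products and the two theta functions. -/

/-- The infinite product `∏ (1 - qⁿ x)`, i.e. the `q`-Pochhammer symbol `(x; q)_∞`. -/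
noncomputable def qProd (q : ℝ) (x : ℂ) : ℂ := ∏' n : ℕ, (1 + -((q : ℂ) ^ n * x))

lemma summable_qProd {q : ℝ} (h0 : 0 < q) (h1 : q < 1) (x : ℂ) :
    Summable fun n : ℕ => ‖-((q : ℂ) ^ n * x)‖ := by
  simp only [norm_neg, norm_mul, norm_pow, Complex.norm_real, Real.norm_eq_abs, abs_of_pos h0]
  exact (summable_geometric_of_lt_one h0.le h1).mul_right _

lemma multipliable_qProd {q : ℝ} (h0 : 0 < q) (h1 : q < 1) (x : ℂ) :
    Multipliable fun n : ℕ => 1 + -((q : ℂ) ^ n * x) :=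
  multipliable_one_add_of_summable (summable_qProd h0 h1 x)

lemma differentiable_qProd {q : ℝ} (h0 : 0 < q) (h1 : q < 1) : Differentiable ℂ (qProd q) := by
  intro z
  have hu : Summable fun n : ℕ => q ^ n * (‖z‖ + 1) :=
    (summable_geometric_of_lt_one h0.le h1).mul_right _
  have hp := (hu.hasProdLocallyUniformlyOn_nat_one_add (f := fun n x => -((q : ℂ) ^ n * x))
    (Metric.isOpen_ball (x := (0 : ℂ)) (ε := ‖z‖ + 1)) (Filter.Eventually.of_forall ?_)
    (fun n => by fun_prop)).differentiableOn ?_ Metric.isOpen_ball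
  · exact hp.differentiableAt (Metric.isOpen_ball.mem_nhds (by simp))
  · intro n x hx
    simp only [norm_neg, norm_mul, norm_pow, Complex.norm_real, Real.norm_eq_abs, abs_of_pos h0]
    have : ‖x‖ ≤ ‖z‖ + 1 := (by simpa using hx : ‖x‖ < ‖z‖ + 1).le
    gcongr
  · exact Filter.Eventually.of_forall fun s => by fun_prop

lemma qProd_eq_mul {q : ℝ} (h0 : 0 < q) (h1 : q < 1) (x : ℂ) :
    qProd q x = (1 - x) * qProd q (q * x) := by
  unfold qProd
  rw [tprod_eq_zero_mul']
  · congr 1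
    · ring
    · refine tprod_congr fun n => ?_
      ring
  · refine (multipliable_qProd h0 h1 (q * x)).congr fun n => ?_
    ring

lemma exists_pow_mul_eq_one_of_qProd_eq_zero {q : ℝ} (h0 : 0 < q) (h1 : q < 1) {x : ℂ}
    (h : qProd q x = 0) : ∃ n : ℕ, (q : ℂ) ^ n * x = 1 := by
  by_contra! hn
  refine tprod_one_add_ne_zero_of_summable (fun n hz => hn n ?_) (summable_qProd h0 h1 x) h
  linear_combination -hz

lemma qProd_ne_zero {q : ℝ} (h0 : 0 < q) (h1 : q < 1) {x : ℂ} (hx : ‖x‖ < 1) :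
    qProd q x ≠ 0 := by
  intro h
  obtain ⟨n, hn⟩ := exists_pow_mul_eq_one_of_qProd_eq_zero h0 h1 h
  have := congrArg norm hn
  simp only [norm_mul, norm_pow, Complex.norm_real, Real.norm_eq_abs, abs_of_pos h0,
    norm_one] at this
  have h2 : q ^ n ≤ 1 := pow_le_one₀ h0.le h1.le
  nlinarith [norm_nonneg x, pow_pos h0 n]

lemma conj_qProd {q : ℝ} (h0 : 0 < q) (h1 : q < 1) (x : ℂ) :
    conj (qProd q x) = qProd q (conj x) := by
  unfold qProd
  rw [Multipliable.map_tprod (multipliable_qProd h0 h1 x) (starRingEnd ℂ) Complex.continuous_conj]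
  simp

/-- The theta product `(x; q)_∞ (q / x; q)_∞`. -/
noncomputable def thetaProd (q : ℝ) (x : ℂ) : ℂ := qProd q x * qProd q (q / x)

/-- Splitting the n = 0 factor off (x; q) and (1/x; q) leaves (qx; q)(q/x; q) on both sides, and (1
- 1/x) = -(1 - x)/x. -/
lemma thetaProd_inv {q : ℝ} (h0 : 0 < q) (h1 : q < 1) {x : ℂ} (hx : x ≠ 0) :
    thetaProd q x⁻¹ = -thetaProd q x / x := by
  unfold thetaProd
  rw [qProd_eq_mul h0 h1 x, qProd_eq_mul h0 h1 x⁻¹, div_inv_eq_mul, ← div_eq_mul_inv]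
  field_simp
  ring

lemma thetaProd_div {q : ℝ} (h0 : 0 < q) {x : ℂ} (hx : x ≠ 0) :
    thetaProd q (q / x) = thetaProd q x := by
  have : (q : ℂ) ≠ 0 := by exact_mod_cast h0.ne'
  unfold thetaProd
  rw [show (q : ℂ) / (q / x) = x by field_simp, mul_comm]

lemma conj_thetaProd {q : ℝ} (h0 : 0 < q) (h1 : q < 1) (x : ℂ) :
    conj (thetaProd q x) = thetaProd q (conj x) := by
  simp [thetaProd, conj_qProd h0 h1]

lemma differentiableAt_thetaProd {q : ℝ} (h0 : 0 < q) (h1 : q < 1) {x : ℂ} (hx : x ≠ 0) :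
    DifferentiableAt ℂ (thetaProd q) x := by
  unfold thetaProd
  refine (differentiable_qProd h0 h1 x).mul ?_
  exact (differentiable_qProd h0 h1 _).comp x (by fun_prop (disch := assumption))

/-- Only the moduli of the zeros are kept: they suffice to tell the zeros of `thetaNum` and
`thetaDen` apart. -/
lemma exists_norm_eq_of_thetaProd_eq_zero {q : ℝ} (h0 : 0 < q) (h1 : q < 1) {x : ℂ} (hx : x ≠ 0)
    (h : thetaProd q x = 0) : ∃ n : ℤ, ‖x‖ = q ^ n := by
  rcases mul_eq_zero.1 h with h | h
  · obtain ⟨n, hn⟩ := exists_pow_mul_eq_one_of_qProd_eq_zero h0 h1 h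
    have := congrArg norm hn
    simp only [norm_mul, norm_pow, Complex.norm_real, Real.norm_eq_abs, abs_of_pos h0,
      norm_one] at this
    refine ⟨-n, ?_⟩
    rw [zpow_neg, zpow_natCast]
    field_simp
    linarith
  · obtain ⟨n, hn⟩ := exists_pow_mul_eq_one_of_qProd_eq_zero h0 h1 h
    have := congrArg norm hn
    simp only [norm_mul, norm_pow, Complex.norm_real, Real.norm_eq_abs, abs_of_pos h0,
      norm_one, norm_div] at this
    refine ⟨n + 1, ?_⟩
    rw [zpow_add₀ h0.ne', zpow_natCast, zpow_one]
    have := norm_ne_zero_iff.2 hx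
    field_simp at *
    linarith

/-- The numerator theta function, with zeros `μ ^ (4 k + 1)`. -/
noncomputable def thetaNum (μ : ℝ) (t : ℂ) : ℂ := μ * thetaProd (μ ^ 4) (t / μ)

/-- The denominator theta function, with zeros `μ ^ (4 k - 1)`. -/
noncomputable def thetaDen (μ : ℝ) (t : ℂ) : ℂ := thetaProd (μ ^ 4) (μ * t)

section
variable {μ : ℝ} (h0 : 0 < μ) (h1 : μ < 1)
include h0 h1

lemma pow_four_lt_one : μ ^ 4 < 1 := pow_lt_one₀ h0.le h1 (by norm_num)

/-- Inversion exchanges the zeros μ^(4k+1) and μ^(4k-1). With `thetaDen_inv` this yields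
unimodularity on |t| = 1 and the reflection symmetry. -/
lemma thetaNum_inv {t : ℂ} (ht : t ≠ 0) : thetaNum μ t⁻¹ = -thetaDen μ t / t := by
  have hμ : (μ : ℂ) ≠ 0 := by exact_mod_cast h0.ne'
  unfold thetaNum thetaDen
  rw [show t⁻¹ / μ = (μ * t)⁻¹ by field_simp,
    thetaProd_inv (by positivity) (pow_four_lt_one h0 h1) (mul_ne_zero hμ ht)]
  field_simp

lemma thetaDen_inv {t : ℂ} (ht : t ≠ 0) : thetaDen μ t⁻¹ = -thetaNum μ t / t := by
  have hμ : (μ : ℂ) ≠ 0 := by exact_mod_cast h0.ne'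
  unfold thetaNum thetaDen
  rw [show μ * t⁻¹ = (t / μ)⁻¹ by field_simp,
    thetaProd_inv (by positivity) (pow_four_lt_one h0 h1) (div_ne_zero ht hμ)]
  field_simp

/-- The map t ↦ μ²/t preserves each of the two zero sets. The factor μ²/t² produced by squaring is
also the one produced by `t * thetaDen μ t ^ 2`, so it cancels in the theta quotient. -/
lemma thetaNum_sq_div {t : ℂ} (ht : t ≠ 0) :
    thetaNum μ (μ ^ 2 / t) = -μ * thetaNum μ t / t := by
  have hμ : (μ : ℂ) ≠ 0 := by exact_mod_cast h0.ne'
  unfold thetaNum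
  rw [show (μ : ℂ) ^ 2 / t / μ = (t / μ)⁻¹ by field_simp,
    thetaProd_inv (by positivity) (pow_four_lt_one h0 h1) (div_ne_zero ht hμ)]
  field_simp

omit h1 in
lemma thetaDen_sq_div {t : ℂ} (ht : t ≠ 0) : thetaDen μ (μ ^ 2 / t) = thetaDen μ t := by
  have hμ : (μ : ℂ) ≠ 0 := by exact_mod_cast h0.ne'
  unfold thetaDen
  rw [← thetaProd_div (q := μ ^ 4) (by positivity) (mul_ne_zero hμ ht)]
  congr 1
  push_cast
  field_simp

lemma conj_thetaNum (t : ℂ) : conj (thetaNum μ t) = thetaNum μ (conj t) := by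
  simp [thetaNum, conj_thetaProd (pow_pos h0 4) (pow_four_lt_one h0 h1)]

lemma conj_thetaDen (t : ℂ) : conj (thetaDen μ t) = thetaDen μ (conj t) := by
  simp [thetaDen, conj_thetaProd (pow_pos h0 4) (pow_four_lt_one h0 h1)]

lemma differentiableAt_thetaNum {t : ℂ} (ht : t ≠ 0) : DifferentiableAt ℂ (thetaNum μ) t := by
  have hμ : (μ : ℂ) ≠ 0 := by exact_mod_cast h0.ne'
  unfold thetaNum
  have := differentiableAt_thetaProd (pow_pos h0 4) (pow_four_lt_one h0 h1) (div_ne_zero ht hμ)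
  exact (this.comp (f := fun t : ℂ => t / μ) t (by fun_prop)).const_mul _

lemma differentiableAt_thetaDen {t : ℂ} (ht : t ≠ 0) : DifferentiableAt ℂ (thetaDen μ) t := by
  have hμ : (μ : ℂ) ≠ 0 := by exact_mod_cast h0.ne'
  unfold thetaDen
  refine (DifferentiableAt.comp t
    (differentiableAt_thetaProd (pow_pos h0 4) (pow_four_lt_one h0 h1) (mul_ne_zero hμ ht)) ?_)
  fun_prop

/-- The factor of `thetaNum` without zeros in `μ ^ 3 < |t| < μ ^ (-1)`. -/
noncomputable def thetaNumFactor (μ : ℝ) (t : ℂ) : ℂ :=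
  -(qProd (μ ^ 4) (μ ^ 3 * t) * qProd (μ ^ 4) (μ ^ 5 / t))

lemma thetaNum_eq_mul (t : ℂ) : thetaNum μ t = (t - μ) * thetaNumFactor μ t := by
  have hμ : (μ : ℂ) ≠ 0 := by exact_mod_cast h0.ne'
  unfold thetaNum thetaNumFactor thetaProd
  rw [qProd_eq_mul (pow_pos h0 4) (pow_four_lt_one h0 h1) (t / μ)]
  rw [show ((μ ^ 4 : ℝ) : ℂ) * (t / μ) = μ ^ 3 * t by push_cast; field_simp,
    show ((μ ^ 4 : ℝ) : ℂ) / (t / μ) = μ ^ 5 / t by push_cast; field_simp]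
  field_simp
  ring

lemma differentiableAt_thetaNumFactor {t : ℂ} (ht : t ≠ 0) :
    DifferentiableAt ℂ (thetaNumFactor μ) t := by
  unfold thetaNumFactor
  have := differentiable_qProd (pow_pos h0 4) (pow_four_lt_one h0 h1)
  refine ((this.comp (by fun_prop)).differentiableAt.mul
    ((this _).comp t ?_)).neg
  fun_prop (disch := assumption)

lemma thetaNumFactor_ne_zero {t : ℂ} (ht : μ ^ 2 < ‖t‖) (ht1 : ‖t‖ < 1) :
    thetaNumFactor μ t ≠ 0 := by
  unfold thetaNumFactor
  have hp : 0 < ‖t‖ := lt_trans (by positivity) ht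
  refine neg_ne_zero.2 (mul_ne_zero (qProd_ne_zero (pow_pos h0 4) (pow_four_lt_one h0 h1) ?_)
    (qProd_ne_zero (pow_pos h0 4) (pow_four_lt_one h0 h1) ?_))
  · simp only [norm_mul, norm_pow, Complex.norm_real, Real.norm_eq_abs, abs_of_pos h0]
    have : μ ^ 3 < 1 := pow_lt_one₀ h0.le h1 (by norm_num)
    nlinarith [pow_pos h0 3]
  · simp only [norm_div, norm_pow, Complex.norm_real, Real.norm_eq_abs, abs_of_pos h0]
    rw [div_lt_one hp]
    refine lt_of_le_of_lt (pow_le_pow_of_le_one h0.le h1.le (by norm_num)) ht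

/-- The zeros nearest to this annulus are μ³ and 1/μ, both outside it. -/
lemma thetaDen_ne_zero {t : ℂ} (ht : μ ^ 2 < ‖t‖) (ht1 : ‖t‖ ≤ 1) : thetaDen μ t ≠ 0 := by
  have hμ : (μ : ℂ) ≠ 0 := by exact_mod_cast h0.ne'
  have hp : 0 < ‖t‖ := lt_trans (by positivity) ht
  have ht0 : t ≠ 0 := norm_pos_iff.1 hp
  unfold thetaDen thetaProd
  refine (mul_ne_zero (qProd_ne_zero (pow_pos h0 4) (pow_four_lt_one h0 h1) ?_)
    (qProd_ne_zero (pow_pos h0 4) (pow_four_lt_one h0 h1) ?_))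
  · simp only [norm_mul, Complex.norm_real, Real.norm_eq_abs, abs_of_pos h0]
    nlinarith
  · simp only [norm_mul, norm_div, norm_pow, Complex.norm_real, Real.norm_eq_abs, abs_of_pos h0]
    rw [div_lt_one (by positivity)]
    nlinarith [pow_pos h0 2, pow_pos h0 3, mul_lt_mul_of_pos_left ht h0,
      mul_lt_mul_of_pos_left h1 (pow_pos h0 3)]

lemma thetaNum_thetaDen_not_both_zero {t : ℂ} (ht : t ≠ 0) (hn : thetaNum μ t = 0)
    (hd : thetaDen μ t = 0) : False := by
  have hμ : (μ : ℂ) ≠ 0 := by exact_mod_cast h0.ne'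
  obtain ⟨n, hn⟩ := exists_norm_eq_of_thetaProd_eq_zero (pow_pos h0 4) (pow_four_lt_one h0 h1)
    (div_ne_zero ht hμ) ((mul_eq_zero.1 hn).resolve_left hμ)
  obtain ⟨m, hm⟩ := exists_norm_eq_of_thetaProd_eq_zero (pow_pos h0 4) (pow_four_lt_one h0 h1)
    (mul_ne_zero hμ ht) hd
  simp only [norm_mul, norm_div, Complex.norm_real, Real.norm_eq_abs, abs_of_pos h0] at hn hm
  rw [← zpow_natCast μ 4, ← zpow_mul] at hn hm
  -- |t/μ| = μ^(4n) and |μt| = μ^(4m) force 4n + 2 = 4m, impossible modulo 4.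
  have h3 : μ ^ (((4 : ℕ) : ℤ) * n + 2) = μ ^ (((4 : ℕ) : ℤ) * m) := by
    rw [zpow_add₀ h0.ne', ← hn, ← hm]
    field_simp
  have := zpow_right_injective₀ h0 h1.ne h3
  push_cast at this
  omega
end

/-! ### Meromorphic functions into the sphere, homogeneous quotients, reflection. -/

open Filter in
lemma SphereMeromorphicAt.congr {f g : ℂ → OnePoint ℂ} {z : ℂ} (hf : SphereMeromorphicAt f z)
    (h : f =ᶠ[𝓝 z] g) : SphereMeromorphicAt g z := by
  obtain ⟨⟨k, hk, hfk⟩, hc⟩ := hf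
  refine ⟨⟨k, hk, ?_⟩, hc.congr h⟩
  filter_upwards [hfk, h.filter_mono nhdsWithin_le_nhds] with w h1 h2
  rw [← h2, h1]

lemma AnalyticAt.sphereMeromorphicAt {g : ℂ → ℂ} {z : ℂ} (hg : AnalyticAt ℂ g z) :
    SphereMeromorphicAt (fun w => (g w : OnePoint ℂ)) z :=
  ⟨⟨g, hg.meromorphicAt, Filter.Eventually.of_forall fun _ => rfl⟩,
    OnePoint.continuous_coe.continuousAt.comp hg.continuousAt⟩

open Filter in
lemma SphereMeromorphicAt.comp {f : ℂ → OnePoint ℂ} {s : ℂ → ℂ} {z : ℂ}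
    (hf : SphereMeromorphicAt f (s z)) (hs : AnalyticAt ℂ s z)
    (h : ∀ᶠ w in 𝓝[≠] z, s w ≠ s z) : SphereMeromorphicAt (fun w => f (s w)) z := by
  obtain ⟨⟨k, hk, hfk⟩, hc⟩ := hf
  refine ⟨⟨k ∘ s, hk.comp_analyticAt hs, ?_⟩, ContinuousAt.comp hc hs.continuousAt⟩
  have : Tendsto s (𝓝[≠] z) (𝓝[≠] (s z)) :=
    tendsto_nhdsWithin_iff.2 ⟨hs.continuousAt.tendsto.mono_left nhdsWithin_le_nhds, h⟩
  exact this.eventually hfk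

open Filter in
-- At a finite value continuity in the sphere gives the meromorphic germ a finite limit, so the
-- singularity is removable.
lemma SphereMeromorphicAt.exists_analyticAt {f : ℂ → OnePoint ℂ} {z c : ℂ}
    (hf : SphereMeromorphicAt f z) (hc : f z = c) :
    ∃ g : ℂ → ℂ, AnalyticAt ℂ g z ∧ ∀ᶠ w in 𝓝 z, f w = (g w : OnePoint ℂ) := by
  obtain ⟨⟨k, hk, hfk⟩, hcont⟩ := hf
  have hne : ∀ᶠ w in 𝓝[≠] z, Function.update k z c w = k w := by
    filter_upwards [self_mem_nhdsWithin] with w hw using Function.update_of_ne hw _ _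
  have hlim : Tendsto k (𝓝[≠] z) (𝓝 c) := by
    have := hcont.tendsto.mono_left (nhdsWithin_le_nhds (s := {z}ᶜ))
    rw [hc] at this
    exact OnePoint.isOpenEmbedding_coe.isEmbedding.tendsto_nhds_iff.2 (this.congr' hfk)
  refine ⟨Function.update k z c, ?_, ?_⟩
  · refine (hk.congr (hne.mono fun w hw => hw.symm)).analyticAt ?_
    exact continuousAt_update_same.2 hlim
  · rw [← nhdsNE_sup_pure, eventually_sup]
    refine ⟨?_, by simpa using hc⟩
    filter_upwards [hfk, hne] with w h1 h2
    rw [h1, h2]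

/-- The point of the Riemann sphere with homogeneous coordinates `(n : d)`. -/
noncomputable def sphereQuot (n d : ℂ) : OnePoint ℂ :=
  if d = 0 then OnePoint.infty else ((n / d : ℂ) : OnePoint ℂ)

lemma sphereQuot_of_ne {n d : ℂ} (hd : d ≠ 0) : sphereQuot n d = ((n / d : ℂ) : OnePoint ℂ) :=
  if_neg hd

lemma sphereQuot_mul {x : ℂ} (hx : x ≠ 0) (n d : ℂ) :
    sphereQuot (x * n) (x * d) = sphereQuot n d := by
  unfold sphereQuot
  by_cases hd : d = 0
  · simp [hd]
  · rw [if_neg hd, if_neg (mul_ne_zero hx hd), mul_div_mul_left _ _ hx]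

lemma sphereReflect_coe_of_ne {z : ℂ} (hz : z ≠ 0) :
    sphereReflect (z : OnePoint ℂ) = ((1 / conj z : ℂ) : OnePoint ℂ) :=
  if_neg hz

lemma sphereReflect_coe_zero : sphereReflect ((0 : ℂ) : OnePoint ℂ) = OnePoint.infty :=
  if_pos rfl

lemma sphereReflect_infty : sphereReflect OnePoint.infty = ((0 : ℂ) : OnePoint ℂ) := rfl

/-- In homogeneous coordinates the reflection is (n : d) ↦ (conj d : conj n); the hypothesis
excludes (0 : 0). -/
lemma sphereReflect_sphereQuot {n d : ℂ} (h : n = 0 → d ≠ 0) :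
    sphereReflect (sphereQuot n d) = sphereQuot (conj d) (conj n) := by
  unfold sphereQuot
  by_cases hd : d = 0
  · have hn : n ≠ 0 := fun hn => h hn hd
    rw [if_pos hd, sphereReflect_infty, if_neg ((map_ne_zero _).2 hn), hd]
    simp
  · rw [if_neg hd]
    by_cases hn : n = 0
    · rw [hn, zero_div, sphereReflect_coe_zero]
      simp
    · rw [sphereReflect_coe_of_ne (div_ne_zero hn hd), if_neg ((map_ne_zero _).2 hn)]
      simp

lemma sphereReflect_sphereReflect (p : OnePoint ℂ) : sphereReflect (sphereReflect p) = p := by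
  induction p using OnePoint.rec with
  | infty => rw [sphereReflect_infty, sphereReflect_coe_zero]
  | coe z =>
    by_cases hz : z = 0
    · rw [hz, sphereReflect_coe_zero, sphereReflect_infty]
    · rw [sphereReflect_coe_of_ne hz, sphereReflect_coe_of_ne (by simpa using hz)]
      simp

lemma exists_norm_eq_one_of_sphereReflect_eq {p : OnePoint ℂ} (h : sphereReflect p = p) :
    ∃ z : ℂ, ‖z‖ = 1 ∧ p = z := by
  induction p using OnePoint.rec with
  | infty => exact absurd h (OnePoint.coe_ne_infty _)
  | coe z =>
    by_cases hz : z = 0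
    · rw [hz, sphereReflect_coe_zero] at h
      exact absurd h (OnePoint.infty_ne_coe _)
    · rw [sphereReflect_coe_of_ne hz, OnePoint.coe_eq_coe] at h
      refine ⟨z, ?_, rfl⟩
      have h2 := congrArg norm h
      rw [norm_div, norm_one, RCLike.norm_conj, div_eq_iff (norm_ne_zero_iff.2 hz)] at h2
      nlinarith [norm_nonneg z]

lemma sphereReflect_coe_eq_coe {z w : ℂ} (h : sphereReflect (z : OnePoint ℂ) = w) :
    ‖w‖ * ‖z‖ = 1 := by
  by_cases hz : z = 0
  · rw [hz, sphereReflect_coe_zero] at h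
    exact absurd h (OnePoint.infty_ne_coe _)
  · rw [sphereReflect_coe_of_ne hz, OnePoint.coe_eq_coe] at h
    rw [← h, norm_div, norm_one, RCLike.norm_conj]
    exact one_div_mul_cancel (norm_ne_zero_iff.2 hz)

/-- A point of the sphere lies in the disc, on the circle, or is the reflection of a point of the
disc. -/
lemma sphere_trichotomy (p : OnePoint ℂ) :
    (∃ z : ℂ, ‖z‖ < 1 ∧ p = z) ∨ (∃ z : ℂ, ‖z‖ = 1 ∧ p = z) ∨
      ∃ z : ℂ, ‖z‖ < 1 ∧ p = sphereReflect z := by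
  induction p using OnePoint.rec with
  | infty => exact Or.inr (Or.inr ⟨0, by simp, sphereReflect_coe_zero.symm⟩)
  | coe z =>
    rcases lt_trichotomy ‖z‖ 1 with h | h | h
    · exact Or.inl ⟨z, h, rfl⟩
    · exact Or.inr (Or.inl ⟨z, h, rfl⟩)
    · have hz : z ≠ 0 := norm_pos_iff.1 (by linarith)
      refine Or.inr (Or.inr ⟨1 / conj z, ?_, ?_⟩)
      · rw [norm_div, norm_one, RCLike.norm_conj, div_lt_one (by linarith)]
        exact h
      · rw [← sphereReflect_coe_of_ne hz, sphereReflect_sphereReflect]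

open Filter in
-- At a zero of D the numerator is nonzero, so |N/D| → ∞, which is convergence to the point at
-- infinity.
lemma sphereMeromorphicAt_sphereQuot {N D : ℂ → ℂ} {z : ℂ} (hN : AnalyticAt ℂ N z)
    (hD : AnalyticAt ℂ D z) (h : N z = 0 → D z ≠ 0) (hne : ∀ᶠ w in 𝓝[≠] z, D w ≠ 0) :
    SphereMeromorphicAt (fun t => sphereQuot (N t) (D t)) z := by
  by_cases hz : D z = 0
  · have hNz : N z ≠ 0 := fun hn => h hn hz
    have hev : ∀ᶠ w in 𝓝[≠] z, sphereQuot (N w) (D w) = ((N w / D w : ℂ) : OnePoint ℂ) := by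
      filter_upwards [hne] with w hw using sphereQuot_of_ne hw
    refine ⟨⟨fun w => N w / D w, hN.meromorphicAt.div hD.meromorphicAt, hev⟩, ?_⟩
    rw [continuousAt_iff_punctured_nhds]
    have hval : sphereQuot (N z) (D z) = OnePoint.infty := if_pos hz
    rw [hval]
    refine Tendsto.congr' (hev.mono fun w hw => hw.symm) ?_
    have h1 : Tendsto (fun w => N w / D w) (𝓝[≠] z) (Bornology.cobounded ℂ) := by
      rw [← tendsto_norm_atTop_iff_cobounded]
      have hD0 : Tendsto D (𝓝[≠] z) (𝓝[≠] 0) :=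
        tendsto_nhdsWithin_iff.2
          ⟨hz ▸ hD.continuousAt.tendsto.mono_left nhdsWithin_le_nhds, hne⟩
      have h2 : Tendsto (fun w => ‖(D w)⁻¹‖) (𝓝[≠] z) atTop :=
        tendsto_norm_cobounded_atTop.comp (tendsto_inv₀_nhdsNE_zero.comp hD0)
      have h3 : Tendsto (fun w => ‖N w‖) (𝓝[≠] z) (𝓝 ‖N z‖) :=
        (hN.continuousAt.tendsto.mono_left nhdsWithin_le_nhds).norm
      refine (h3.pos_mul_atTop (norm_pos_iff.2 hNz) h2).congr fun w => ?_
      rw [← norm_mul, div_eq_mul_inv]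
    have h4 := OnePoint.tendsto_coe_infty (X := ℂ)
    rw [coclosedCompact_eq_cocompact, ← Metric.cobounded_eq_cocompact] at h4
    exact h4.comp h1
  · have hd : ∀ᶠ w in 𝓝 z, D w ≠ 0 := hD.continuousAt.eventually_ne hz
    refine (hN.div hD hz).sphereMeromorphicAt.congr ?_
    filter_upwards [hd] with w hw using (sphereQuot_of_ne hw).symm

/-! ### Injective holomorphic functions and their inverses. -/

section injective
open Filter Set Function

variable {g : ℂ → ℂ} {U : Set ℂ}

lemma Set.InjOn.nhds_le_map (hU : IsOpen U) (hg : DifferentiableOn ℂ g U) (hi : InjOn g U)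
    {z : ℂ} (hz : z ∈ U) : 𝓝 (g z) ≤ map g (𝓝 z) := by
  refine ((hg.analyticAt (hU.mem_nhds hz)).eventually_constant_or_nhds_le_map_nhds).resolve_left ?_
  intro h
  have h2 : ∀ᶠ w in 𝓝 z, w = z := by
    filter_upwards [h, hU.mem_nhds hz] with w hw hwU using hi hwU hz hw
  have h3 : ∀ᶠ w in 𝓝[≠] z, False := by
    filter_upwards [h2.filter_mono nhdsWithin_le_nhds, self_mem_nhdsWithin] with w h4 h5 using h5 h4
  exact h3.exists.elim fun _ h => h

lemma Set.InjOn.continuousAt_invFunOn (hU : IsOpen U) (hg : DifferentiableOn ℂ g U)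
    (hi : InjOn g U) {z : ℂ} (hz : z ∈ U) : ContinuousAt (invFunOn g U) (g z) := by
  have hl : invFunOn g U (g z) = z := hi.leftInvOn_invFunOn hz
  rw [ContinuousAt, hl]
  refine Tendsto.mono_left ?_ (hi.nhds_le_map hU hg hz)
  rw [tendsto_map'_iff]
  refine tendsto_id.congr' ?_
  filter_upwards [hU.mem_nhds hz] with w hw using (hi.leftInvOn_invFunOn hw).symm

/-- No prior knowledge of g' ≠ 0 is needed: the zeros of g' are isolated, so the inverse is
differentiable on a punctured neighbourhood, and continuity removes the singularity. That g' ≠ 0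
then follows by the chain rule in `Set.InjOn.deriv_ne_zero`. -/
lemma Set.InjOn.analyticAt_invFunOn (hU : IsOpen U) (hg : DifferentiableOn ℂ g U)
    (hi : InjOn g U) {z : ℂ} (hz : z ∈ U) : AnalyticAt ℂ (invFunOn g U) (g z) := by
  have hgz := hg.analyticAt (hU.mem_nhds hz)
  have hcont := hi.continuousAt_invFunOn hU hg hz
  have hl : invFunOn g U (g z) = z := hi.leftInvOn_invFunOn hz
  have hmapU : ∀ᶠ y in 𝓝 (g z), y ∈ g '' U :=
    hi.nhds_le_map hU hg hz (image_mem_map (hU.mem_nhds hz))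
  have hd : ∀ᶠ w in 𝓝[≠] z, deriv g w ≠ 0 := by
    -- If g' vanished identically near z, g would be constant on a ball, against injectivity.
    refine hgz.deriv.eventually_eq_zero_or_eventually_ne_zero.resolve_left fun h0 => ?_
    obtain ⟨ε, hε, hball⟩ := Metric.eventually_nhds_iff_ball.1
      (h0.and (hU.eventually_mem hz))
    have hconst : ∀ w ∈ Metric.ball z ε, g w = g z := by
      intro w hw
      refine (convex_ball z ε).is_const_of_fderivWithin_eq_zero (𝕜 := ℂ)
        (fun x hx => ((hg.differentiableAt (hU.mem_nhds (hball x hx).2))).differentiableWithinAt)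
        (fun x hx => ?_) hw (Metric.mem_ball_self hε)
      rw [fderivWithin_of_isOpen Metric.isOpen_ball hx]
      ext
      simpa using (hball x hx).1
    have hw : z + (ε / 2 : ℝ) ∈ Metric.ball z ε := by
      simp [abs_of_pos hε, hε]
    have := hi (hball _ hw).2 hz (hconst _ hw)
    have h5 : ((ε / 2 : ℝ) : ℂ) = 0 := by linear_combination this
    have : ε / 2 = 0 := by exact_mod_cast h5
    linarith
  refine Complex.analyticAt_of_differentiable_on_punctured_nhds_of_continuousAt ?_ hcont
  have ht : Tendsto (invFunOn g U) (𝓝[≠] (g z)) (𝓝[≠] z) := by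
    refine tendsto_nhdsWithin_iff.2
      ⟨by simpa only [hl] using hcont.tendsto.mono_left nhdsWithin_le_nhds, ?_⟩
    filter_upwards [self_mem_nhdsWithin, hmapU.filter_mono nhdsWithin_le_nhds] with y hy hyU h
    rw [mem_singleton_iff] at h
    exact hy (by rw [mem_singleton_iff, ← h, invFunOn_eq hyU])
  filter_upwards [ht.eventually hd, hmapU.filter_mono nhdsWithin_le_nhds] with y hy hyU
  obtain ⟨w, hw, rfl⟩ := hyU
  have hlw : invFunOn g U (g w) = w := hi.leftInvOn_invFunOn hw
  rw [hlw] at hy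
  have hgw : HasDerivAt g (deriv g w) (invFunOn g U (g w)) := by
    rw [hlw]
    exact (hg.differentiableAt (hU.mem_nhds hw)).hasDerivAt
  refine (HasDerivAt.of_local_left_inverse (hi.continuousAt_invFunOn hU hg hw) hgw hy
    ?_).differentiableAt
  filter_upwards [hi.nhds_le_map hU hg hw (image_mem_map (hU.mem_nhds hw))] with y hy
    using invFunOn_eq hy

lemma Set.InjOn.deriv_ne_zero (hU : IsOpen U) (hg : DifferentiableOn ℂ g U) (hi : InjOn g U)
    {z : ℂ} (hz : z ∈ U) : deriv g z ≠ 0 := by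
  have hgz := hg.analyticAt (hU.mem_nhds hz)
  have hana := hi.analyticAt_invFunOn hU hg hz
  have hleft : ∀ᶠ w in 𝓝 z, invFunOn g U (g w) = w := by
    filter_upwards [hU.mem_nhds hz] with w hw using hi.leftInvOn_invFunOn hw
  have hcomp := (hana.differentiableAt.hasDerivAt).comp z hgz.differentiableAt.hasDerivAt
  have hid : HasDerivAt (invFunOn g U ∘ g) 1 z :=
    (hasDerivAt_id z).congr_of_eventuallyEq hleft
  intro h0
  rw [h0, mul_zero] at hcomp
  exact zero_ne_one (hcomp.unique hid)

end injective

/-! ### The Joukowski map, the parameter `μ`, and the algebra of ψ ∘ λ. -/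

lemma isPreconnected_norm_preimage {I : Set ℝ} (hI : IsPreconnected I) (h0 : ∀ r ∈ I, 0 ≤ r) :
    IsPreconnected {z : ℂ | ‖z‖ ∈ I} := by
  have : {z : ℂ | ‖z‖ ∈ I} =
      (fun p : ℝ × ℝ => (p.1 : ℂ) * Complex.exp (p.2 * Complex.I)) '' (I ×ˢ Set.univ) := by
    ext z
    constructor
    · intro hz
      exact ⟨(‖z‖, z.arg), ⟨hz, trivial⟩, Complex.norm_mul_exp_arg_mul_I z⟩
    · rintro ⟨⟨r, θ⟩, ⟨hr, -⟩, rfl⟩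
      simp only [Set.mem_ofPred_eq, norm_mul, Complex.norm_real, Complex.norm_exp_ofReal_mul_I,
        mul_one, Real.norm_eq_abs, abs_of_nonneg (h0 r hr)]
      exact hr
  rw [this]
  exact (hI.prod isPreconnected_univ).image _ (by fun_prop)

lemma add_one_div_eq_iff {x y : ℂ} (hx : x ≠ 0) (hy : y ≠ 0) :
    x + 1 / x = y + 1 / y ↔ x = y ∨ x * y = 1 := by
  have : x + 1 / x - (y + 1 / y) = (x - y) * (x * y - 1) / (x * y) := by
    field_simp
    ring
  rw [← sub_eq_zero, this, div_eq_zero_iff, mul_eq_zero, sub_eq_zero, sub_eq_zero]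
  simp [hx, hy]

/-- The two roots of u² - zu + 1 have product 1, so one of them has modulus at least 1. -/
lemma exists_add_one_div_eq (z : ℂ) : ∃ u : ℂ, 1 ≤ ‖u‖ ∧ u + 1 / u = z := by
  obtain ⟨s, hs⟩ := IsAlgClosed.exists_pow_nat_eq (z ^ 2 - 4) (n := 2) (by norm_num)
  have key : ∀ u v : ℂ, u * v = 1 → u + v = z → 1 ≤ ‖u‖ → ∃ u : ℂ, 1 ≤ ‖u‖ ∧ u + 1 / u = z := by
    intro u v huv hz hu
    have hu0 : u ≠ 0 := left_ne_zero_of_mul_eq_one huv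
    refine ⟨u, hu, ?_⟩
    rw [← hz, ← huv]
    field_simp
  have h1 : (z + s) / 2 * ((z - s) / 2) = 1 := by linear_combination -hs / 4
  rcases le_total 1 ‖(z + s) / 2‖ with h | h
  · exact key _ _ h1 (by ring) h
  · refine key _ _ (by rw [mul_comm]; exact h1) (by ring) ?_
    have h2 := congrArg norm h1
    rw [norm_mul, norm_one] at h2
    nlinarith [norm_nonneg ((z - s) / 2)]

/-- μ is the smaller root of x² - Rx + 1. The later lemmas use only these three facts, not the
square root. -/
lemma muNum_spec {R : ℝ} (hR : 2 < R) :
    0 < muNum R ∧ muNum R < 1 ∧ R * muNum R = muNum R ^ 2 + 1 := by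
  have h4 : 0 < R ^ 2 - 4 := by nlinarith
  have hs := Real.sq_sqrt h4.le
  have hp := Real.sqrt_pos.2 h4
  unfold muNum
  refine ⟨?_, ?_, ?_⟩
  · nlinarith
  · nlinarith
  · linear_combination -hs / 4

/-- The preimage `R λ(t) - 1` of `ψ(λ(t))` under the Joukowski map. -/
noncomputable def joukParam (μ : ℝ) (t : ℂ) : ℂ := (t - μ ^ 3) / (μ * (μ * t - 1))

section
variable {R μ : ℝ} (h0 : 0 < μ) (h1 : μ < 1) (hR : R * μ = μ ^ 2 + 1)

section
include h0

lemma mul_sub_one_ne_zero {t : ℂ} (ht : μ * ‖t‖ < 1) : (μ : ℂ) * t - 1 ≠ 0 := by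
  intro h
  have := congrArg norm (sub_eq_zero.1 h)
  rw [norm_mul, Complex.norm_real, Real.norm_eq_abs, abs_of_pos h0, norm_one] at this
  linarith

lemma sub_pow_ne_zero {t : ℂ} (ht : μ ^ 3 < ‖t‖) : t - (μ : ℂ) ^ 3 ≠ 0 := by
  intro h
  have := congrArg norm (sub_eq_zero.1 h)
  rw [norm_pow, Complex.norm_real, Real.norm_eq_abs, abs_of_pos h0] at this
  linarith

lemma joukParam_ne_zero {t : ℂ} (ht : μ ^ 3 < ‖t‖) (ht1 : μ * ‖t‖ < 1) : joukParam μ t ≠ 0 :=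
  div_ne_zero (sub_pow_ne_zero h0 ht)
    (mul_ne_zero (by exact_mod_cast h0.ne') (mul_sub_one_ne_zero h0 ht1))

include hR in
lemma two_lt_of_mul_eq (h1 : μ < 1) : 2 < R := by
  have : 0 < (R - 2) * μ := by nlinarith [sq_nonneg (μ - 1), mul_pos (sub_pos.2 h1) (sub_pos.2 h1)]
  nlinarith [pos_of_mul_pos_left this h0.le]

include hR in
lemma mul_lambdaMap_sub_one {t : ℂ} (ht : (μ : ℂ) * t - 1 ≠ 0) :
    (R : ℂ) * lambdaMap μ t - 1 = joukParam μ t := by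
  have hμ : (μ : ℂ) ≠ 0 := by exact_mod_cast h0.ne'
  have hRc : (R : ℂ) * μ = μ ^ 2 + 1 := by exact_mod_cast hR
  unfold lambdaMap joukParam
  rw [eq_div_iff (mul_ne_zero hμ ht), mul_div_assoc', sub_mul, div_mul_eq_mul_div,
    div_sub' ht, div_eq_iff ht]
  linear_combination (t - μ) * (μ * t - 1) * hRc

include hR in
lemma psiMap_lambdaMap {t : ℂ} (ht : (μ : ℂ) * t - 1 ≠ 0) :
    psiMap R (lambdaMap μ t) = joukParam μ t + 1 / joukParam μ t := by
  unfold psiMap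
  rw [mul_lambdaMap_sub_one h0 hR ht]

/-- The annulus μ³ < |t| < 1/μ avoids the zero μ³ and the pole 1/μ of `joukParam`, and t ↦ μ²/t
exchanges its two boundary circles. -/
lemma sq_div_bounds {t : ℂ} (ht : μ ^ 3 < ‖t‖) (ht1 : μ * ‖t‖ < 1) :
    μ ^ 3 < ‖(μ : ℂ) ^ 2 / t‖ ∧ μ * ‖(μ : ℂ) ^ 2 / t‖ < 1 := by
  have hp : 0 < ‖t‖ := lt_trans (by positivity) ht
  rw [norm_div, norm_pow, Complex.norm_real, Real.norm_eq_abs, abs_of_pos h0]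
  constructor
  · rw [lt_div_iff₀ hp]
    nlinarith [pow_pos h0 2]
  · rw [mul_div_assoc', div_lt_one hp]
    linarith [pow_succ' μ 2]

/-- This makes t ↦ μ²/t the deck transformation of ψ ∘ λ, since u + 1/u is unchanged under u ↦ 1/u.
-/
lemma joukParam_sq_div {t : ℂ} (ht : μ ^ 3 < ‖t‖) (ht1 : μ * ‖t‖ < 1) :
    joukParam μ (μ ^ 2 / t) = 1 / joukParam μ t := by
  have hμ : (μ : ℂ) ≠ 0 := by exact_mod_cast h0.ne'
  have ht0 : t ≠ 0 := norm_pos_iff.1 (lt_trans (by positivity) ht)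
  have h3 := sub_pow_ne_zero h0 ht
  have h4 := mul_sub_one_ne_zero h0 ht1
  have h5 : (μ : ℂ) * (μ ^ 2 / t) - 1 ≠ 0 := mul_sub_one_ne_zero h0 (sq_div_bounds h0 ht ht1).2
  unfold joukParam
  rw [one_div_div, div_eq_div_iff (mul_ne_zero hμ h5) h3]
  field_simp
  ring

include hR in
lemma psiMap_lambdaMap_sq_div {t : ℂ} (ht : μ ^ 3 < ‖t‖) (ht1 : μ * ‖t‖ < 1) :
    psiMap R (lambdaMap μ (μ ^ 2 / t)) = psiMap R (lambdaMap μ t) := by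
  rw [psiMap_lambdaMap h0 hR (mul_sub_one_ne_zero h0 ht1),
    psiMap_lambdaMap h0 hR (mul_sub_one_ne_zero h0 (sq_div_bounds h0 ht ht1).2),
    joukParam_sq_div h0 ht ht1, one_div_one_div, add_comm]

include h1

lemma one_sub_sq_ne_zero : (1 : ℂ) - μ ^ 2 ≠ 0 := by
  have : (1 : ℝ) - μ ^ 2 ≠ 0 := by nlinarith
  exact_mod_cast this

lemma mul_lambdaMap_sub_one_ne_zero {t : ℂ} (ht : (μ : ℂ) * t - 1 ≠ 0) :
    (μ : ℂ) * lambdaMap μ t - 1 ≠ 0 := by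
  unfold lambdaMap
  rw [mul_div_assoc', div_sub_one ht]
  refine div_ne_zero ?_ ht
  have := one_sub_sq_ne_zero h0 h1
  contrapose! this
  linear_combination this

lemma lambdaMap_lambdaMap {t : ℂ} (ht : (μ : ℂ) * t - 1 ≠ 0) :
    lambdaMap μ (lambdaMap μ t) = t := by
  have h2 := mul_lambdaMap_sub_one_ne_zero h0 h1 ht
  rw [lambdaMap, div_eq_iff h2]
  unfold lambdaMap
  rw [div_sub' ht, mul_div_assoc', div_sub_one ht, mul_div_assoc', div_left_inj' ht]
  ring

lemma lambdaMap_injective {s t : ℂ} (hs : (μ : ℂ) * s - 1 ≠ 0) (ht : (μ : ℂ) * t - 1 ≠ 0)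
    (h : lambdaMap μ s = lambdaMap μ t) : s = t := by
  rw [← lambdaMap_lambdaMap h0 h1 hs, h, lambdaMap_lambdaMap h0 h1 ht]

omit h0 h1 in
lemma norm_lambdaMap_sq (μ : ℝ) (t : ℂ) : ‖t - μ‖ ^ 2 - ‖(μ : ℂ) * t - 1‖ ^ 2 =
    (‖t‖ ^ 2 - 1) * (1 - μ ^ 2) := by
  simp only [Complex.sq_norm, Complex.normSq_apply, Complex.sub_re, Complex.sub_im,
    Complex.mul_re, Complex.mul_im, Complex.ofReal_re, Complex.ofReal_im, Complex.one_re,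
    Complex.one_im]
  ring

lemma norm_lambdaMap_le_one_iff {t : ℂ} (ht : (μ : ℂ) * t - 1 ≠ 0) :
    ‖lambdaMap μ t‖ ≤ 1 ↔ ‖t‖ ≤ 1 := by
  have h2 := norm_pos_iff.2 ht
  have h3 := norm_lambdaMap_sq μ t
  have h4 : 0 < 1 - μ ^ 2 := by nlinarith
  rw [lambdaMap, norm_div, div_le_one h2, ← sq_le_sq₀ (norm_nonneg _) (norm_nonneg _),
    ← sq_le_one_iff₀ (norm_nonneg t)]
  constructor
  · intro h
    by_contra! h5
    nlinarith [mul_pos (sub_pos.2 h5) h4]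
  · intro h
    nlinarith

lemma norm_lambdaMap_lt_one_iff {t : ℂ} (ht : (μ : ℂ) * t - 1 ≠ 0) :
    ‖lambdaMap μ t‖ < 1 ↔ ‖t‖ < 1 := by
  have h2 := norm_pos_iff.2 ht
  have h3 := norm_lambdaMap_sq μ t
  have h4 : 0 < 1 - μ ^ 2 := by nlinarith
  rw [lambdaMap, norm_div, div_lt_one h2, ← sq_lt_sq₀ (norm_nonneg _) (norm_nonneg _),
    ← sq_lt_one_iff₀ (norm_nonneg t)]
  constructor
  · intro h
    by_contra! h5
    nlinarith [mul_nonneg (sub_nonneg.2 h5) h4.le]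
  · intro h
    nlinarith [mul_pos (sub_pos.2 h) h4]

/-- The circle |u| = 1 corresponds to |t| = μ, the fixed circle of |t| ↦ μ²/|t|. Thus choosing the
root with |u| ≥ 1 selects the outer half of the annulus. -/
lemma one_le_norm_joukParam_iff {t : ℂ} (ht : (μ : ℂ) * t - 1 ≠ 0) :
    1 ≤ ‖joukParam μ t‖ ↔ μ ≤ ‖t‖ := by
  have h2 := norm_pos_iff.2 ht
  have h3 : ‖t - (μ : ℂ) ^ 3‖ ^ 2 - (μ * ‖(μ : ℂ) * t - 1‖) ^ 2 =
      (1 - μ ^ 4) * (‖t‖ ^ 2 - μ ^ 2) := by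
    rw [mul_pow, ← Complex.ofReal_pow]
    simp only [Complex.sq_norm, Complex.normSq_apply, Complex.sub_re, Complex.sub_im,
      Complex.mul_re, Complex.mul_im, Complex.ofReal_re, Complex.ofReal_im, Complex.one_re,
      Complex.one_im]
    ring
  have h4 : 0 < 1 - μ ^ 4 := sub_pos.2 (pow_four_lt_one h0 h1)
  rw [joukParam, norm_div, norm_mul, Complex.norm_real, Real.norm_eq_abs, abs_of_pos h0,
    one_le_div (mul_pos h0 h2), ← sq_le_sq₀ (by positivity) (norm_nonneg _),
    ← sq_le_sq₀ h0.le (norm_nonneg t)]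
  constructor
  · intro h
    by_contra! h5
    nlinarith [mul_pos (sub_pos.2 h5) h4]
  · intro h
    nlinarith

include hR

/-- As λ is an involution, the only candidate is t = λ(w) with w = (u + 1)/R. It maps the line Re w
= (1 + μ²)/(2μ) = R/2 to the circle |t| = 1/μ, so |w| < R/2 gives μ|t| < 1. -/
lemma exists_annulus_of_norm_lt {u : ℂ} (hu : 1 ≤ ‖u‖) (hu2 : ‖u + 1‖ < R ^ 2 / 2) :
    ∃ t : ℂ, μ ≤ ‖t‖ ∧ μ * ‖t‖ < 1 ∧ (R : ℂ) * lambdaMap μ t = u + 1 ∧ joukParam μ t = u := by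
  have hR2 := two_lt_of_mul_eq h0 hR h1
  have hRc : (R : ℂ) ≠ 0 := by
    have : R ≠ 0 := by linarith
    exact_mod_cast this
  set w : ℂ := (u + 1) / R with hw
  have hwn : ‖w‖ < R / 2 := by
    rw [hw, norm_div, Complex.norm_real, Real.norm_eq_abs, abs_of_pos (by linarith),
      div_lt_iff₀ (by linarith)]
    linarith [sq R]
  have hRμ : μ * (R / 2) < 1 := by nlinarith
  have hw1 : (μ : ℂ) * w - 1 ≠ 0 := by
    refine mul_sub_one_ne_zero h0 ?_
    nlinarith
  have hw2 := mul_lambdaMap_sub_one_ne_zero h0 h1 hw1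
  have hl : (R : ℂ) * lambdaMap μ (lambdaMap μ w) = u + 1 := by
    rw [lambdaMap_lambdaMap h0 h1 hw1, hw]
    field_simp
  have hj : joukParam μ (lambdaMap μ w) = u := by
    rw [← mul_lambdaMap_sub_one h0 hR hw2, hl]
    ring
  refine ⟨lambdaMap μ w, ?_, ?_, hl, hj⟩
  · rw [← one_le_norm_joukParam_iff h0 h1 hw2, hj]
    exact hu
  · have hp := norm_pos_iff.2 hw1
    rw [lambdaMap, norm_div, mul_div_assoc', div_lt_one hp]
    have h3 : (μ * ‖w - μ‖) ^ 2 - ‖(μ : ℂ) * w - 1‖ ^ 2 =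
        (1 - μ ^ 2) * (2 * μ * w.re - (1 + μ ^ 2)) := by
      rw [mul_pow]
      simp only [Complex.sq_norm, Complex.normSq_apply, Complex.sub_re, Complex.sub_im,
        Complex.mul_re, Complex.mul_im, Complex.ofReal_re, Complex.ofReal_im, Complex.one_re,
        Complex.one_im]
      ring
    rw [← sq_lt_sq₀ (by positivity) (norm_nonneg _)]
    have h4 : w.re < R / 2 := lt_of_le_of_lt (Complex.re_le_norm w) hwn
    have h5 : 2 * μ * w.re - (1 + μ ^ 2) < 0 := by nlinarith
    have h6 : 0 < 1 - μ ^ 2 := by nlinarith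
    nlinarith [mul_pos_of_neg_of_neg (neg_neg_of_pos h6) h5]

omit h1 in
-- The two Joukowski roots over ψ(λ(t)) are `joukParam μ t` and its inverse, which is `joukParam` at
-- μ²/t.
lemma eq_joukParam_of_add_one_div_eq {u t : ℂ} (hu : u ≠ 0) (ht : μ ^ 3 < ‖t‖)
    (ht1 : μ * ‖t‖ < 1) (h : u + 1 / u = psiMap R (lambdaMap μ t)) :
    ∃ s, (s = t ∨ s = μ ^ 2 / t) ∧ u = joukParam μ s ∧ u + 1 = R * lambdaMap μ s := by
  have hj := joukParam_ne_zero h0 ht ht1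
  have key : ∀ s, (μ : ℂ) * s - 1 ≠ 0 → u = joukParam μ s → u + 1 = R * lambdaMap μ s := by
    intro s hs hus
    rw [hus, ← mul_lambdaMap_sub_one h0 hR hs]
    ring
  rw [psiMap_lambdaMap h0 hR (mul_sub_one_ne_zero h0 ht1), add_one_div_eq_iff hu hj] at h
  rcases h with h | h
  · exact ⟨t, Or.inl rfl, h, key _ (mul_sub_one_ne_zero h0 ht1) h⟩
  · have h2 : u = joukParam μ (μ ^ 2 / t) := by
      rw [joukParam_sq_div h0 ht ht1, eq_div_iff hj, h]
    exact ⟨_, Or.inr rfl, h2,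
      key _ (mul_sub_one_ne_zero h0 (sq_div_bounds h0 ht ht1).2) h2⟩

lemma psiMap_lambdaMap_eq_iff {s t : ℂ} (hs : μ ^ 3 < ‖s‖) (hs1 : μ * ‖s‖ < 1)
    (ht : μ ^ 3 < ‖t‖) (ht1 : μ * ‖t‖ < 1) :
    psiMap R (lambdaMap μ s) = psiMap R (lambdaMap μ t) ↔ s = t ∨ s = μ ^ 2 / t := by
  have hRc : (R : ℂ) ≠ 0 := by
    have : R ≠ 0 := by linarith [two_lt_of_mul_eq h0 hR h1]
    exact_mod_cast this
  constructor
  · intro h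
    rw [psiMap_lambdaMap h0 hR (mul_sub_one_ne_zero h0 hs1)] at h
    obtain ⟨r, hr, -, h2⟩ := eq_joukParam_of_add_one_div_eq h0 hR
      (joukParam_ne_zero h0 hs hs1) ht ht1 h
    have hr1 : (μ : ℂ) * r - 1 ≠ 0 := by
      rcases hr with rfl | rfl
      · exact mul_sub_one_ne_zero h0 ht1
      · exact mul_sub_one_ne_zero h0 (sq_div_bounds h0 ht ht1).2
    rw [← mul_lambdaMap_sub_one h0 hR (mul_sub_one_ne_zero h0 hs1), sub_add_cancel] at h2
    have := lambdaMap_injective h0 h1 (mul_sub_one_ne_zero h0 hs1) hr1 (mul_left_cancel₀ hRc h2)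
    rwa [this]
  · rintro (rfl | rfl)
    · rfl
    · exact psiMap_lambdaMap_sq_div h0 hR ht ht1

omit h1 in
/-- The derivative of `ψ ∘ λ`. -/
lemma hasDerivAt_psiMap_lambdaMap {t : ℂ} (ht : μ ^ 3 < ‖t‖) (ht1 : μ * ‖t‖ < 1) :
    HasDerivAt (fun t => psiMap R (lambdaMap μ t))
      (-((1 - μ ^ 4) ^ 2 * (t - μ ^ 2 / t) /
        (μ * t * (1 - μ * t) ^ 2 * (1 - μ ^ 3 / t) ^ 2))) t := by
  have hμ : (μ : ℂ) ≠ 0 := by exact_mod_cast h0.ne'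
  have ht0 : t ≠ 0 := norm_pos_iff.1 (lt_trans (by positivity) ht)
  have h3 := sub_pow_ne_zero h0 ht
  have h4 := mul_sub_one_ne_zero h0 ht1
  have h4' : 1 - (μ : ℂ) * t ≠ 0 := by
    contrapose! h4
    linear_combination -h4
  have hj := joukParam_ne_zero h0 ht ht1
  have hd : HasDerivAt (joukParam μ) (-(1 - μ ^ 4) / (μ * (μ * t - 1) ^ 2)) t := by
    have := ((hasDerivAt_id t).sub_const ((μ : ℂ) ^ 3)).div
      ((((hasDerivAt_id t).const_mul (μ : ℂ)).sub_const 1).const_mul (μ : ℂ))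
      (mul_ne_zero hμ h4)
    refine this.congr_deriv ?_
    simp only [id]
    field_simp
    ring
  have hd2 := hd.add (hd.inv hj)
  have hev : (fun t => psiMap R (lambdaMap μ t)) =ᶠ[𝓝 t] joukParam μ + (joukParam μ)⁻¹ := by
    have hc : ContinuousAt (fun s : ℂ => (μ : ℂ) * s - 1) t := by fun_prop
    filter_upwards [hc.eventually_ne h4] with s hs
    rw [psiMap_lambdaMap h0 hR hs]
    simp
  refine (hd2.congr_of_eventuallyEq hev).congr_deriv ?_
  have h5 : 1 - (μ : ℂ) ^ 3 / t ≠ 0 := by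
    rw [one_sub_div ht0]
    exact div_ne_zero h3 ht0
  unfold joukParam
  have e1 : (μ : ℂ) * t - 1 = -(1 - μ * t) := by ring
  have e2 : 1 - (μ : ℂ) ^ 3 / t = (t - μ ^ 3) / t := by field_simp
  rw [e2, e1]
  field_simp
  ring

end
end

/-! ### G₁ and G_{1/ρ} described by annuli in the t-plane. -/

section
open Set Metric
variable {R μ : ℝ} (h0 : 0 < μ) (h1 : μ < 1) (hR : R * μ = μ ^ 2 + 1)

section
include h0 h1

lemma annulus_bounds {t : ℂ} (ht : μ ^ 2 ≤ ‖t‖) (ht1 : ‖t‖ ≤ 1) :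
    μ ^ 3 < ‖t‖ ∧ μ * ‖t‖ < 1 := by
  constructor
  · nlinarith [mul_lt_mul_of_pos_left h1 (pow_pos h0 2)]
  · nlinarith

omit h1 in
lemma sq_div_annulus {t : ℂ} (ht : μ ^ 2 < ‖t‖) (ht1 : ‖t‖ < 1) :
    μ ^ 2 < ‖(μ : ℂ) ^ 2 / t‖ ∧ ‖(μ : ℂ) ^ 2 / t‖ < 1 := by
  have hp : 0 < ‖t‖ := lt_trans (by positivity) ht
  rw [norm_div, norm_pow, Complex.norm_real, Real.norm_eq_abs, abs_of_pos h0]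
  rw [lt_div_iff₀ hp, div_lt_one hp]
  exact ⟨by nlinarith [pow_pos h0 2], ht⟩

omit h1 in
lemma sq_div_closed_annulus {t : ℂ} (ht : μ ^ 2 ≤ ‖t‖) (ht1 : ‖t‖ ≤ 1) :
    μ ^ 2 ≤ ‖(μ : ℂ) ^ 2 / t‖ ∧ ‖(μ : ℂ) ^ 2 / t‖ ≤ 1 := by
  have hp : 0 < ‖t‖ := lt_of_lt_of_le (by positivity) ht
  rw [norm_div, norm_pow, Complex.norm_real, Real.norm_eq_abs, abs_of_pos h0]
  rw [le_div_iff₀ hp, div_le_one hp]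
  exact ⟨by nlinarith [pow_pos h0 2], ht⟩

end

/-- The open annulus on which `ψ ∘ λ` covers the domain. -/
def openAnnulus (μ : ℝ) : Set ℂ := {t | ‖t‖ ∈ Ioo (μ ^ 2) 1}

/-- The closure of `openAnnulus`. -/
def closedAnnulus (μ : ℝ) : Set ℂ := {t | ‖t‖ ∈ Icc (μ ^ 2) 1}

lemma isPreconnected_openAnnulus (μ : ℝ) : IsPreconnected (openAnnulus μ) :=
  isPreconnected_norm_preimage isPreconnected_Ioo fun _ hr => (sq_nonneg μ).trans hr.1.le

lemma isOpen_openAnnulus (μ : ℝ) : IsOpen (openAnnulus μ) :=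
  isOpen_Ioo.preimage continuous_norm

lemma isCompact_closedAnnulus (μ : ℝ) : IsCompact (closedAnnulus μ) := by
  refine isCompact_of_isClosed_isBounded (isClosed_Icc.preimage continuous_norm) ?_
  exact isBounded_iff_forall_norm_le.2 ⟨1, fun x hx => hx.2⟩

/-- The image of the open annulus under `ψ ∘ λ`. -/
def coveredDomain (R μ : ℝ) : Set ℂ := (fun t => psiMap R (lambdaMap μ t)) '' openAnnulus μ

/-- The image of the closed annulus under `ψ ∘ λ`. -/
def coveredClosure (R μ : ℝ) : Set ℂ := (fun t => psiMap R (lambdaMap μ t)) '' closedAnnulus μ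

lemma coveredDomain_subset : coveredDomain R μ ⊆ coveredClosure R μ :=
  image_mono fun _ ht => ⟨ht.1.le, ht.2.le⟩

/-- The image under the Joukowski map of the exterior of a disc centred at `-1`. -/
def exteriorImage (r : ℝ) : Set ℂ := (fun u : ℂ => u + 1 / u) '' {u | r < ‖u + 1‖}

lemma one_lt_norm_of_two_lt {u : ℂ} (h : 2 < ‖u + 1‖) : 1 < ‖u‖ := by
  have := norm_add_le u 1
  rw [norm_one] at this
  linarith

lemma isPreconnected_exteriorImage {r : ℝ} (hr : 2 ≤ r) : IsPreconnected (exteriorImage r) := by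
  have h : IsPreconnected {v : ℂ | ‖v‖ ∈ Ioi r} :=
    isPreconnected_norm_preimage isPreconnected_Ioi fun x hx => by
      have : r < x := hx
      linarith
  have h2 : {u : ℂ | r < ‖u + 1‖} = (fun v : ℂ => v - 1) '' {v : ℂ | ‖v‖ ∈ Ioi r} := by
    ext u
    constructor
    · intro hu
      exact ⟨u + 1, hu, by ring⟩
    · rintro ⟨v, hv, rfl⟩
      simpa using hv
  unfold exteriorImage
  refine IsPreconnected.image ?_ _ ?_
  · rw [h2]
    exact h.image _ (by fun_prop)
  · intro u hu
    have hu' : r < ‖u + 1‖ := hu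
    have hu0 : u ≠ 0 := norm_pos_iff.1 (by linarith [one_lt_norm_of_two_lt (hr.trans_lt hu')])
    exact ContinuousAt.continuousWithinAt (by fun_prop (disch := assumption))

include h0 hR

lemma continuousOn_psiMap_lambdaMap (h1 : μ < 1) :
    ContinuousOn (fun t => psiMap R (lambdaMap μ t)) (closedAnnulus μ) := fun _ ht =>
  (hasDerivAt_psiMap_lambdaMap h0 hR (annulus_bounds h0 h1 ht.1 ht.2).1
    (annulus_bounds h0 h1 ht.1 ht.2).2).continuousAt.continuousWithinAt

lemma isCompact_coveredClosure (h1 : μ < 1) : IsCompact (coveredClosure R μ) :=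
  (isCompact_closedAnnulus μ).image_of_continuousOn (continuousOn_psiMap_lambdaMap h0 hR h1)

include h1

lemma isOpen_coveredDomain : IsOpen (coveredDomain R μ) := by
  have hb : ∀ t ∈ openAnnulus μ, μ ^ 3 < ‖t‖ ∧ μ * ‖t‖ < 1 := fun t ht =>
    annulus_bounds h0 h1 ht.1.le ht.2.le
  have ha : AnalyticOnNhd ℂ (fun t => psiMap R (lambdaMap μ t)) (openAnnulus μ) := by
    refine DifferentiableOn.analyticOnNhd (fun t ht => ?_) (isOpen_openAnnulus μ)
    exact (hasDerivAt_psiMap_lambdaMap h0 hR (hb t ht).1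
      (hb t ht).2).differentiableAt.differentiableWithinAt
  refine (ha.is_constant_or_isOpen (isPreconnected_openAnnulus μ)).resolve_left ?_ _ Subset.rfl
    (isOpen_openAnnulus μ)
  rintro ⟨w, hw⟩
  have hm : ((μ : ℝ) : ℂ) ∈ openAnnulus μ := by
    simp only [openAnnulus, mem_ofPred_eq, Complex.norm_real, Real.norm_eq_abs, abs_of_pos h0]
    exact ⟨by nlinarith, h1⟩
  -- The fibre through μ is a single point, since μ²/μ = μ; any other point of the annulus therefore
  -- shows that the map is not constant.
  have hs : (((μ + 1) / 2 : ℝ) : ℂ) ∈ openAnnulus μ := by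
    have : 0 < (μ + 1) / 2 := by linarith
    simp only [openAnnulus, mem_ofPred_eq, Complex.norm_real, Real.norm_eq_abs, abs_of_pos this]
    exact ⟨by nlinarith, by linarith⟩
  have h := (hw _ hs).trans (hw _ hm).symm
  rw [psiMap_lambdaMap_eq_iff h0 h1 hR (hb _ hs).1 (hb _ hs).2 (hb _ hm).1 (hb _ hm).2] at h
  have hμ : (μ : ℂ) ≠ 0 := by exact_mod_cast h0.ne'
  have h3 : (((μ + 1) / 2 : ℝ) : ℂ) = (μ : ℂ) := by
    rcases h with h | h
    · exact h
    · rw [h]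
      field_simp
  have h4 : (μ + 1) / 2 = μ := by exact_mod_cast h3
  linarith

/-- Any root of the Joukowski equation over the open annulus satisfies `|u + 1| < R`. -/
lemma norm_add_one_lt {u t : ℂ} (hu : u ≠ 0) (ht : t ∈ openAnnulus μ)
    (h : u + 1 / u = psiMap R (lambdaMap μ t)) : ‖u + 1‖ < R := by
  have hR2 := two_lt_of_mul_eq h0 hR h1
  obtain ⟨hb, hb1⟩ := annulus_bounds h0 h1 ht.1.le ht.2.le
  obtain ⟨s, hs, -, h2⟩ := eq_joukParam_of_add_one_div_eq h0 hR hu hb hb1 h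
  have hs1 : s ∈ openAnnulus μ := by
    rcases hs with rfl | rfl
    · exact ht
    · exact sq_div_annulus h0 ht.1 ht.2
  have hl := (norm_lambdaMap_lt_one_iff h0 h1 (mul_sub_one_ne_zero h0
    (annulus_bounds h0 h1 hs1.1.le hs1.2.le).2)).2 hs1.2
  rw [h2, norm_mul, Complex.norm_real, Real.norm_eq_abs, abs_of_pos (by linarith)]
  nlinarith

/-- Any root of the Joukowski equation over the closed annulus satisfies `|u + 1| ≤ R`. -/
lemma norm_add_one_le {u t : ℂ} (hu : u ≠ 0) (ht : t ∈ closedAnnulus μ)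
    (h : u + 1 / u = psiMap R (lambdaMap μ t)) : ‖u + 1‖ ≤ R := by
  have hR2 := two_lt_of_mul_eq h0 hR h1
  obtain ⟨hb, hb1⟩ := annulus_bounds h0 h1 ht.1 ht.2
  obtain ⟨s, hs, -, h2⟩ := eq_joukParam_of_add_one_div_eq h0 hR hu hb hb1 h
  have hs1 : s ∈ closedAnnulus μ := by
    rcases hs with rfl | rfl
    · exact ht
    · exact sq_div_closed_annulus h0 ht.1 ht.2
  have hl := (norm_lambdaMap_le_one_iff h0 h1 (mul_sub_one_ne_zero h0
    (annulus_bounds h0 h1 hs1.1 hs1.2).2)).2 hs1.2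
  rw [h2, norm_mul, Complex.norm_real, Real.norm_eq_abs, abs_of_pos (by linarith)]
  nlinarith

lemma exteriorImage_inter_coveredClosure : Disjoint (exteriorImage R) (coveredClosure R μ) := by
  have hR2 := two_lt_of_mul_eq h0 hR h1
  rw [disjoint_left]
  rintro z ⟨u, hu, rfl⟩ ⟨t, ht, h⟩
  have hu' : R < ‖u + 1‖ := hu
  have hu0 : u ≠ 0 := norm_pos_iff.1 (by linarith [one_lt_norm_of_two_lt (hR2.trans hu')])
  linarith [norm_add_one_le h0 h1 hR hu0 ht h.symm]

/-- Take the root with |u| ≥ 1. Either |u + 1| > R, or t = λ((u + 1)/R) satisfies μ ≤ |t| ≤ 1. -/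
lemma exteriorImage_union_coveredClosure (z : ℂ) (hz : z ∉ coveredClosure R μ) :
    z ∈ exteriorImage R := by
  have hR2 := two_lt_of_mul_eq h0 hR h1
  obtain ⟨u, hu, rfl⟩ := exists_add_one_div_eq z
  by_contra h
  have hu1 : ‖u + 1‖ ≤ R := not_lt.1 fun h2 => h ⟨u, h2, rfl⟩
  obtain ⟨t, ht, ht1, hl, hj⟩ := exists_annulus_of_norm_lt h0 h1 hR hu (by nlinarith)
  have hm := mul_sub_one_ne_zero h0 ht1
  refine hz ⟨t, ⟨by nlinarith, ?_⟩, ?_⟩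
  · rw [← norm_lambdaMap_le_one_iff h0 h1 hm]
    rw [← hl, norm_mul, Complex.norm_real, Real.norm_eq_abs, abs_of_pos (by linarith)] at hu1
    nlinarith
  · change psiMap R (lambdaMap μ t) = _
    rw [psiMap_lambdaMap h0 hR hm, hj]

lemma curveL_inter_coveredDomain : Disjoint (curveL R) (coveredDomain R μ) := by
  have hR2 := two_lt_of_mul_eq h0 hR h1
  rw [disjoint_left]
  rintro z ⟨w, hw, rfl⟩ ⟨t, ht, h⟩
  rw [mem_sphere_zero_iff_norm] at hw
  have hw1 : 1 < ‖w - 1‖ := one_lt_norm_of_two_lt (by rw [sub_add_cancel, hw]; exact hR2)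
  have hu0 : w - 1 ≠ 0 := norm_pos_iff.1 (by linarith)
  have := norm_add_one_lt h0 h1 hR hu0 ht (by rw [one_div]; exact h.symm)
  rw [sub_add_cancel, hw] at this
  exact lt_irrefl _ this

lemma psiMap_lambdaMap_mem_curveL {t : ℂ} (ht : ‖t‖ = 1) :
    psiMap R (lambdaMap μ t) ∈ curveL R := by
  have hR2 := two_lt_of_mul_eq h0 hR h1
  have hm := mul_sub_one_ne_zero h0 (t := t) (by rw [ht]; linarith)
  refine ⟨R * lambdaMap μ t, ?_, ?_⟩
  · have h3 := norm_lambdaMap_sq μ t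
    rw [ht] at h3
    have h4 : ‖t - μ‖ = ‖(μ : ℂ) * t - 1‖ :=
      (sq_eq_sq₀ (norm_nonneg _) (norm_nonneg _)).1 (by linarith)
    rw [mem_sphere_zero_iff_norm, norm_mul, Complex.norm_real, Real.norm_eq_abs,
      abs_of_pos (by linarith), lambdaMap, norm_div, h4, div_self (norm_ne_zero_iff.2 hm), mul_one]
  · simp only [psiMap, one_div]

/-- The circle |t| = 1 goes into L₁ directly, and |t| = μ² does so after the deck transformation. -/
lemma coveredClosure_subset : coveredClosure R μ ⊆ curveL R ∪ coveredDomain R μ := by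
  rintro z ⟨t, ht, rfl⟩
  obtain ⟨hb, hb1⟩ := annulus_bounds h0 h1 ht.1 ht.2
  rcases ht.2.eq_or_lt with h | h
  · exact Or.inl (psiMap_lambdaMap_mem_curveL h0 h1 hR h)
  rcases ht.1.eq_or_lt with h' | h'
  · left
    change psiMap R (lambdaMap μ t) ∈ _
    rw [← psiMap_lambdaMap_sq_div h0 hR hb hb1]
    refine psiMap_lambdaMap_mem_curveL h0 h1 hR ?_
    rw [norm_div, norm_pow, Complex.norm_real, Real.norm_eq_abs, abs_of_pos h0, ← h']
    exact div_self (by positivity)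
  · exact Or.inr ⟨t, ⟨h', h⟩, rfl⟩

lemma curveL_subset : curveL R ⊆ coveredClosure R μ := by
  have hR2 := two_lt_of_mul_eq h0 hR h1
  intro z hz
  by_contra h
  obtain ⟨u, hu, rfl⟩ := exteriorImage_union_coveredClosure h0 h1 hR z h
  obtain ⟨w, hw, h2⟩ := hz
  rw [mem_sphere_zero_iff_norm] at hw
  have hu' : R < ‖u + 1‖ := hu
  have hu1 := one_lt_norm_of_two_lt (hR2.trans hu')
  have hw1 : 1 < ‖w - 1‖ := one_lt_norm_of_two_lt (by rw [sub_add_cancel, hw]; exact hR2)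
  have hu0 : u ≠ 0 := norm_pos_iff.1 (by linarith)
  have hw0 : w - 1 ≠ 0 := norm_pos_iff.1 (by linarith)
  simp only [← one_div] at h2
  rw [add_one_div_eq_iff hw0 hu0] at h2
  rcases h2 with h2 | h2
  · rw [← h2, sub_add_cancel, hw] at hu'
    exact lt_irrefl _ hu'
  · have h3 := congrArg norm h2
    rw [norm_mul, norm_one] at h3
    nlinarith

/-- The plane is the union of the covered domain, L₁ and the exterior image. The last is connected
and unbounded, so none of its points is interior to L₁; a component that meets the covered domain
cannot leave it. -/
lemma domainG_eq : domainG R = coveredDomain R μ := by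
  have hR2 := two_lt_of_mul_eq h0 hR h1
  have hcomp := isCompact_coveredClosure h0 hR h1
  ext z
  constructor
  · rintro ⟨hzL, hzb⟩
    by_contra hz
    have hzK : z ∉ coveredClosure R μ := fun h =>
      (coveredClosure_subset h0 h1 hR h).elim hzL hz
    have hzE := exteriorImage_union_coveredClosure h0 h1 hR z hzK
    have hEL : exteriorImage R ⊆ (curveL R)ᶜ := fun x hx hxL =>
      disjoint_left.1 (exteriorImage_inter_coveredClosure h0 h1 hR) hx
        (curveL_subset h0 h1 hR hxL)
    have hEb := hzb.subset
      ((isPreconnected_exteriorImage hR2.le).subset_connectedComponentIn hzE hEL)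
    -- A bounded exterior image together with the compact covered closure would make the whole plane
    -- bounded.
    have huniv : (univ : Set ℂ) ⊆ exteriorImage R ∪ coveredClosure R μ := fun x _ => by
      by_cases hx : x ∈ coveredClosure R μ
      · exact Or.inr hx
      · exact Or.inl (exteriorImage_union_coveredClosure h0 h1 hR x hx)
    exact NormedSpace.unbounded_univ ℂ ℂ ((hEb.union hcomp.isBounded).subset huniv)
  · intro hz
    have hzL : z ∈ (curveL R)ᶜ := fun h =>
      disjoint_left.1 (curveL_inter_coveredDomain h0 h1 hR) h hz
    refine ⟨hzL, hcomp.isBounded.subset ?_⟩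
    -- The covered domain and the complement of its compact closure are disjoint open sets covering
    -- the complement of L₁.
    have hsub : connectedComponentIn (curveL R)ᶜ z ⊆ coveredDomain R μ := by
      refine isPreconnected_connectedComponentIn.subset_left_of_subset_union
        (isOpen_coveredDomain h0 h1 hR) hcomp.isClosed.isOpen_compl ?_ ?_
        ⟨z, mem_connectedComponentIn hzL, hz⟩
      · exact disjoint_left.2 fun x hx hx2 => hx2 (coveredDomain_subset hx)
      · intro x hx
        have hxL := connectedComponentIn_subset _ _ hx
        by_cases hxK : x ∈ coveredClosure R μ
        · exact Or.inl ((coveredClosure_subset h0 h1 hR hxK).resolve_left hxL)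
        · exact Or.inr hxK
    exact hsub.trans coveredDomain_subset

omit h0 h1 hR in
lemma psiMap_image_eq {r : ℝ} (hRp : 0 < R) :
    psiMap R '' {w : ℂ | r < ‖w‖} = exteriorImage (R * r) := by
  have hRc : (R : ℂ) ≠ 0 := by exact_mod_cast hRp.ne'
  ext z
  constructor
  · rintro ⟨w, hw, rfl⟩
    refine ⟨R * w - 1, ?_, rfl⟩
    have hw' : r < ‖w‖ := hw
    rw [mem_ofPred_eq, sub_add_cancel, norm_mul, Complex.norm_real, Real.norm_eq_abs,
      abs_of_pos hRp]
    exact mul_lt_mul_of_pos_left hw' hRp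
  · rintro ⟨u, hu, rfl⟩
    refine ⟨(u + 1) / R, ?_, ?_⟩
    · rw [mem_ofPred_eq, norm_div, Complex.norm_real, Real.norm_eq_abs, abs_of_pos hRp,
        lt_div_iff₀ hRp, mul_comm]
      exact hu
    · unfold psiMap
      rw [mul_div_cancel₀ _ hRc, add_sub_cancel_right]

omit h0 h1 hR in
lemma levelG_eq (hR2 : 2 < R) :
    levelG R (1 / rhoNum R) = (closure (exteriorImage (R ^ 2 / 2)))ᶜ := by
  unfold levelG rhoNum
  rw [psiMap_image_eq (by linarith), one_div_div]
  congr 3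
  ring

lemma domainG_subset_levelG : domainG R ⊆ levelG R (1 / rhoNum R) := by
  have hR2 := two_lt_of_mul_eq h0 hR h1
  rw [levelG_eq hR2, domainG_eq h0 h1 hR]
  refine subset_compl_iff_disjoint_right.2
    (Disjoint.closure_right ?_ (isOpen_coveredDomain h0 h1 hR))
  refine Disjoint.symm ((exteriorImage_inter_coveredClosure h0 h1 hR).mono (image_mono ?_)
    coveredDomain_subset)
  intro u hu
  have hu' : R ^ 2 / 2 < ‖u + 1‖ := hu
  change R < ‖u + 1‖
  nlinarith

lemma exists_of_mem_levelG {z : ℂ} (hz : z ∈ levelG R (1 / rhoNum R)) :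
    ∃ t : ℂ, μ ≤ ‖t‖ ∧ μ * ‖t‖ < 1 ∧ psiMap R (lambdaMap μ t) = z := by
  have hR2 := two_lt_of_mul_eq h0 hR h1
  rw [levelG_eq hR2] at hz
  obtain ⟨u, hu, rfl⟩ := exists_add_one_div_eq z
  by_cases h : ‖u + 1‖ < R ^ 2 / 2
  · obtain ⟨t, ht, ht1, -, hj⟩ := exists_annulus_of_norm_lt h0 h1 hR hu h
    refine ⟨t, ht, ht1, ?_⟩
    rw [psiMap_lambdaMap h0 hR (mul_sub_one_ne_zero h0 ht1), hj]
  · exfalso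
    have hu0 : u ≠ 0 := norm_pos_iff.1 (by linarith)
    -- The boundary case |u + 1| = R²/2 must be excluded too: moving u away from -1 by ε/2 enters
    -- the open exterior.
    have hcl : u ∈ closure {u : ℂ | R ^ 2 / 2 < ‖u + 1‖} := by
      have hv : 0 < ‖u + 1‖ := lt_of_lt_of_le (by positivity) (not_lt.1 h)
      rw [Metric.mem_closure_iff]
      intro ε hε
      refine ⟨u + (ε / (2 * ‖u + 1‖) : ℝ) * (u + 1), ?_, ?_⟩
      · have e : u + (ε / (2 * ‖u + 1‖) : ℝ) * (u + 1) + 1 =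
            ((1 + ε / (2 * ‖u + 1‖) : ℝ) : ℂ) * (u + 1) := by
          push_cast
          ring
        rw [mem_ofPred_eq, e, norm_mul, Complex.norm_real, Real.norm_eq_abs,
          abs_of_pos (by positivity)]
        have : (1 + ε / (2 * ‖u + 1‖)) * ‖u + 1‖ = ‖u + 1‖ + ε / 2 := by
          field_simp
        linarith [not_lt.1 h]
      · rw [dist_self_add_right, norm_mul, Complex.norm_real, Real.norm_eq_abs,
          abs_of_pos (by positivity)]
        have : ε / (2 * ‖u + 1‖) * ‖u + 1‖ = ε / 2 := by
          field_simp
        linarith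
    refine hz (ContinuousAt.continuousWithinAt ?_ |>.mem_closure_image hcl)
    fun_prop (disch := assumption)

/-- ψ is injective on |w| > ρ, where |Rw - 1| > 1, and open on ρ < |w| < 1/ρ. The image of that
annulus is thus a neighbourhood of ψ(w) disjoint from ψ({|w| > 1/ρ}). -/
lemma psiMap_mem_levelG {w : ℂ} (hw : rhoNum R < ‖w‖) (hw1 : ‖w‖ < 1 / rhoNum R) :
    psiMap R w ∈ levelG R (1 / rhoNum R) := by
  have hR2 := two_lt_of_mul_eq h0 hR h1
  have hRp : 0 < R := by linarith
  set V : Set ℂ := {w : ℂ | ‖w‖ ∈ Ioo (rhoNum R) (1 / rhoNum R)} with hV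
  have hVo : IsOpen V := isOpen_Ioo.preimage continuous_norm
  have hn : ∀ w : ℂ, rhoNum R < ‖w‖ → 1 < ‖(R : ℂ) * w - 1‖ := by
    intro w hw
    refine one_lt_norm_of_two_lt ?_
    rw [sub_add_cancel, norm_mul, Complex.norm_real, Real.norm_eq_abs, abs_of_pos hRp]
    rw [rhoNum, div_lt_iff₀ hRp] at hw
    linarith
  have hne : ∀ w : ℂ, rhoNum R < ‖w‖ → (R : ℂ) * w - 1 ≠ 0 := fun w hw =>
    norm_pos_iff.1 (by linarith [hn w hw])
  have hinj : ∀ w v : ℂ, rhoNum R < ‖w‖ → rhoNum R < ‖v‖ → psiMap R w = psiMap R v → w = v := by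
    intro w v hw hv h
    unfold psiMap at h
    rw [add_one_div_eq_iff (hne w hw) (hne v hv)] at h
    rcases h with h | h
    · have hRc : (R : ℂ) ≠ 0 := by exact_mod_cast hRp.ne'
      exact mul_left_cancel₀ hRc (by linear_combination h)
    · have h3 := congrArg norm h
      rw [norm_mul, norm_one] at h3
      nlinarith [hn w hw, hn v hv]
  have hd : DifferentiableOn ℂ (psiMap R) V := by
    intro w hw
    have := hne w hw.1
    unfold psiMap
    exact DifferentiableAt.differentiableWithinAt (by fun_prop (disch := assumption))
  have hopen : psiMap R '' V ∈ 𝓝 (psiMap R w) :=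
    Set.InjOn.nhds_le_map hVo hd (fun w hw v hv h => hinj w v hw.1 hv.1 h) ⟨hw, hw1⟩
      (Filter.image_mem_map (hVo.mem_nhds ⟨hw, hw1⟩))
  unfold levelG
  rw [mem_compl_iff, mem_closure_iff_nhds]
  intro h
  obtain ⟨z, ⟨v, hv, hvz⟩, ⟨x, hx, hxz⟩⟩ := h _ hopen
  have hx' : 1 / rhoNum R < ‖x‖ := hx
  have hv' := hv.2
  have := hinj v x hv.1 (hv.1.trans (hv'.trans hx')) (hvz.trans hxz.symm)
  rw [this] at hv'
  exact lt_asymm hv' hx'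

end

/-! ### Boundary behaviour and the theta formula for φ ∘ ψ ∘ λ. -/

section
open Set Metric Filter

/-- Closedness of the norm turns statements near each point of the unit circle into statements
uniform in the angle. -/
lemma isClosedMap_norm_complex : IsClosedMap (norm : ℂ → ℝ) := by
  refine (isProperMap_iff_tendsto_cocompact.2 ⟨continuous_norm, ?_⟩).isClosedMap
  exact (tendsto_norm_cocompact_atTop (E := ℂ)).mono_right atTop_le_cocompact

/-- A property that holds near every point of the unit circle holds near the circle. -/
lemma eventually_comap_norm {p : ℂ → Prop} (h : ∀ z : ℂ, ‖z‖ = 1 → ∀ᶠ w in 𝓝 z, p w) :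
    ∀ᶠ w in comap (norm : ℂ → ℝ) (𝓝 1), p w := by
  have := isClosedMap_norm_complex.comap_nhds_le (y := 1)
  refine this ?_
  rw [mem_nhdsSet_iff_forall]
  exact fun x hx => h x hx

lemma tendsto_comap_norm {S : ℂ → ℝ} (h : ∀ z : ℂ, ‖z‖ = 1 → Tendsto S (𝓝 z) (𝓝 1)) :
    Tendsto S (comap (norm : ℂ → ℝ) (𝓝 1)) (𝓝 1) := fun _ hV =>
  eventually_comap_norm fun z hz => h z hz hV

/-- Apply the maximum principle on μ²/r < |t| < r with r near 1. The symmetry moves the inner circle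
to the outer one, so the limit at |t| = 1 alone controls both. -/
lemma norm_le_one_of_tendsto {μ : ℝ} (h0 : 0 < μ) {Q : ℂ → ℂ}
    (hQ : DifferentiableOn ℂ Q (openAnnulus μ))
    (hsymm : ∀ t ∈ openAnnulus μ, Q (μ ^ 2 / t) = Q t)
    (hlim : Tendsto (fun t => ‖Q t‖) (comap (norm : ℂ → ℝ) (𝓝[<] 1)) (𝓝 1)) :
    ∀ t ∈ openAnnulus μ, ‖Q t‖ ≤ 1 := by
  intro t ht
  refine le_of_forall_pos_le_add fun ε hε => ?_
  have h2 : ∀ᶠ t in comap (norm : ℂ → ℝ) (𝓝[<] 1), ‖Q t‖ < 1 + ε :=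
    hlim.eventually_lt_const (by linarith)
  rw [eventually_comap] at h2
  have ht0 : 0 < ‖t‖ := lt_trans (by positivity) ht.1
  have e1 : ∀ᶠ r in 𝓝[<] (1 : ℝ), ‖t‖ < r := (eventually_gt_nhds ht.2).filter_mono inf_le_left
  have e2 : ∀ᶠ r in 𝓝[<] (1 : ℝ), μ ^ 2 / ‖t‖ < r :=
    (eventually_gt_nhds ((div_lt_one ht0).2 ht.1)).filter_mono inf_le_left
  obtain ⟨r, ⟨⟨hr, htr⟩, htr2⟩, hr1⟩ := (((h2.and e1).and e2).and self_mem_nhdsWithin).exists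
  have hr1 : r < 1 := hr1
  have hr0 : 0 < r := ht0.trans htr
  have htl : μ ^ 2 / r < ‖t‖ := by
    rw [div_lt_iff₀ ht0] at htr2
    rw [div_lt_iff₀ hr0]
    linarith
  have hμr : μ ^ 2 < μ ^ 2 / r := by
    rw [lt_div_iff₀ hr0]
    nlinarith [pow_pos h0 2]
  set W : Set ℂ := norm ⁻¹' Ioo (μ ^ 2 / r) r with hW
  have hcl : closure W ⊆ norm ⁻¹' Icc (μ ^ 2 / r) r := by
    refine closure_minimal (preimage_mono Ioo_subset_Icc_self)
      (isClosed_Icc.preimage continuous_norm)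
  have hclA : closure W ⊆ openAnnulus μ := fun x hx =>
    ⟨hμr.trans_le (hcl hx).1, (hcl hx).2.trans_lt hr1⟩
  have hbd : Bornology.IsBounded W :=
    isBounded_iff_forall_norm_le.2 ⟨r, fun x hx => hx.2.le⟩
  refine Complex.norm_le_of_forall_mem_frontier_norm_le hbd (hQ.mono hclA).diffContOnCl ?_
    (subset_closure (show t ∈ W from ⟨htl, htr⟩))
  intro x hx
  have hxA := hclA (frontier_subset_closure hx)
  have hx2 := continuous_norm.frontier_preimage_subset _ hx
  rw [frontier_Ioo (htl.trans htr)] at hx2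
  rcases hx2 with hx2 | hx2
  · replace hx2 : ‖x‖ = μ ^ 2 / r := hx2
    rw [← hsymm x hxA]
    refine (hr _ ?_).le
    rw [norm_div, norm_pow, Complex.norm_real, Real.norm_eq_abs, abs_of_pos h0, hx2]
    field_simp
  · exact (hr x hx2).le

lemma one_sub_conj_mul_ne_zero {a z : ℂ} (ha : ‖a‖ < 1) (hz : ‖z‖ ≤ 1) : 1 - conj a * z ≠ 0 := by
  intro h
  have := congrArg norm (sub_eq_zero.1 h)
  rw [norm_one, norm_mul, RCLike.norm_conj] at this
  nlinarith [norm_nonneg z, norm_nonneg a]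

lemma mobius_norm_sq (a z : ℂ) : ‖1 - conj a * z‖ ^ 2 - ‖z - a‖ ^ 2 =
    (1 - ‖a‖ ^ 2) * (1 - ‖z‖ ^ 2) := by
  simp only [Complex.sq_norm, Complex.normSq_apply, Complex.sub_re, Complex.sub_im,
    Complex.mul_re, Complex.mul_im, Complex.conj_re, Complex.conj_im, Complex.one_re,
    Complex.one_im]
  ring

/-- Only |f| has a limit, so continuity of the Möbius map does not apply. Instead 1 - |M|² = (1 -
|a|²)(1 - |f|²)/|1 - conj(a) f|², whose denominator stays away from 0. -/
lemma tendsto_norm_mobius {l : Filter ℂ} {f : ℂ → ℂ} {a : ℂ} (ha : ‖a‖ < 1)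
    (hf : Tendsto (fun t => ‖f t‖) l (𝓝 1)) :
    Tendsto (fun t => ‖(f t - a) / (1 - conj a * f t)‖) l (𝓝 1) := by
  have hlow : ∀ᶠ t in l, (1 - ‖a‖) / 2 < ‖1 - conj a * f t‖ := by
    have h2 : Tendsto (fun t => 1 - ‖a‖ * ‖f t‖) l (𝓝 (1 - ‖a‖ * 1)) :=
      tendsto_const_nhds.sub (hf.const_mul _)
    filter_upwards [h2.eventually_const_lt (show (1 - ‖a‖) / 2 < 1 - ‖a‖ * 1 by linarith)] with t ht
    have := norm_sub_norm_le (1 : ℂ) (conj a * f t)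
    rw [norm_one, norm_mul, RCLike.norm_conj] at this
    linarith
  have hsq : Tendsto (fun t => ‖(f t - a) / (1 - conj a * f t)‖ ^ 2) l (𝓝 1) := by
    have hnum : Tendsto (fun t => |(1 - ‖a‖ ^ 2) * (1 - ‖f t‖ ^ 2)| / ((1 - ‖a‖) / 2) ^ 2) l
        (𝓝 0) := by
      have : Tendsto (fun t => |(1 - ‖a‖ ^ 2) * (1 - ‖f t‖ ^ 2)| / ((1 - ‖a‖) / 2) ^ 2) l
          (𝓝 (|(1 - ‖a‖ ^ 2) * (1 - 1 ^ 2)| / ((1 - ‖a‖) / 2) ^ 2)) :=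
        (((hf.pow 2).const_sub 1).const_mul _).abs.div_const _
      simpa using this
    rw [tendsto_iff_norm_sub_tendsto_zero]
    refine squeeze_zero' (Eventually.of_forall fun _ => norm_nonneg _) ?_ hnum
    filter_upwards [hlow] with t ht
    have hp : 0 < (1 - ‖a‖) / 2 := by linarith
    have hq : 0 < ‖1 - conj a * f t‖ := hp.trans ht
    rw [norm_div, div_pow, div_sub_one (by positivity), norm_div, Real.norm_eq_abs, Real.norm_eq_abs,
      abs_of_pos (pow_pos hq 2), ← abs_neg, neg_sub, mobius_norm_sq]
    gcongr
  have := hsq.sqrt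
  simpa only [Real.sqrt_sq (norm_nonneg _), Real.sqrt_one] using this

variable {R μ : ℝ} (h0 : 0 < μ) (h1 : μ < 1) (hR : R * μ = μ ^ 2 + 1)

/-- On the unit circle conj t = 1/t, and inversion turns `thetaNum` into `thetaDen` up to a
unimodular factor. -/
lemma norm_thetaNum_eq (h0 : 0 < μ) (h1 : μ < 1) {t : ℂ} (ht : ‖t‖ = 1) :
    ‖thetaNum μ t‖ = ‖thetaDen μ t‖ := by
  have ht0 : t ≠ 0 := norm_pos_iff.1 (by rw [ht]; exact one_pos)
  have h2 : conj t = t⁻¹ := by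
    rw [Complex.inv_def, Complex.normSq_eq_norm_sq, ht]
    simp
  have h3 := conj_thetaNum h0 h1 t
  rw [h2, thetaNum_inv h0 h1 ht0] at h3
  have := congrArg norm h3
  rwa [RCLike.norm_conj, norm_div, norm_neg, ht, div_one] at this

lemma tendsto_norm_thetaQuot (h0 : 0 < μ) (h1 : μ < 1) :
    Tendsto (fun t => ‖thetaNum μ t ^ 2 / (t * thetaDen μ t ^ 2)‖)
      (comap (norm : ℂ → ℝ) (𝓝 1)) (𝓝 1) := by
  refine tendsto_comap_norm fun z hz => ?_
  have hz0 : z ≠ 0 := norm_pos_iff.1 (by rw [hz]; exact one_pos)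
  have hd : thetaDen μ z ≠ 0 := thetaDen_ne_zero h0 h1 (by rw [hz]; nlinarith) hz.le
  have hc : ContinuousAt (fun t => ‖thetaNum μ t ^ 2 / (t * thetaDen μ t ^ 2)‖) z := by
    have c1 := (differentiableAt_thetaNum h0 h1 hz0).continuousAt
    have c2 := (differentiableAt_thetaDen h0 h1 hz0).continuousAt
    exact ((c1.pow 2).div (continuousAt_id.mul (c2.pow 2))
      (mul_ne_zero hz0 (pow_ne_zero 2 hd))).norm
  have hv : ‖thetaNum μ z ^ 2 / (z * thetaDen μ z ^ 2)‖ = 1 := by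
    rw [norm_div, norm_mul, norm_pow, norm_pow, norm_thetaNum_eq h0 h1 hz, hz, one_mul]
    exact div_self (pow_ne_zero 2 (norm_ne_zero_iff.2 hd))
  have := hc.tendsto
  rwa [hv] at this

lemma comap_norm_le : comap (norm : ℂ → ℝ) (𝓝[<] 1) ≤ comap (norm : ℂ → ℝ) (𝓝 1) :=
  comap_mono inf_le_left

lemma eventually_mem_openAnnulus (h0 : 0 < μ) (h1 : μ < 1) :
    ∀ᶠ t in comap (norm : ℂ → ℝ) (𝓝[<] 1), t ∈ openAnnulus μ := by
  have h2 : ∀ᶠ r in 𝓝[<] (1 : ℝ), μ ^ 2 < r :=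
    (eventually_gt_nhds (by nlinarith)).filter_mono inf_le_left
  have h3 : ∀ᶠ r in 𝓝[<] (1 : ℝ), r < 1 := self_mem_nhdsWithin
  exact (h2.and h3).comap _

include h0 h1 hR

/-- A conformal map onto the disc has modulus tending to one at the boundary. -/
lemma tendsto_norm_conformal {φ : ℂ → ℂ} (hφ : ConformalOnto φ (domainG R) (ball 0 1)) :
    Tendsto (fun t => ‖φ (psiMap R (lambdaMap μ t))‖) (comap (norm : ℂ → ℝ) (𝓝[<] 1)) (𝓝 1) := by
  obtain ⟨hd, hbij⟩ := hφ
  have hopen : IsOpen (domainG R) := by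
    rw [domainG_eq h0 h1 hR]
    exact isOpen_coveredDomain h0 h1 hR
  have hA := eventually_mem_openAnnulus h0 h1
  have hin : ∀ t ∈ openAnnulus μ, psiMap R (lambdaMap μ t) ∈ domainG R := fun t ht => by
    rw [domainG_eq h0 h1 hR]
    exact mem_image_of_mem _ ht
  refine tendsto_order.2 ⟨fun r hr => ?_, fun r hr => ?_⟩
  -- K is the compact preimage under φ of a closed disc of radius r < 1; ψ(λ(t)) leaves it as t
  -- approaches the circle because it approaches L₁.
  · set K : Set ℂ := Function.invFunOn φ (domainG R) '' closedBall 0 r with hK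
    have hKc : IsCompact K := by
      refine (isCompact_closedBall 0 r).image_of_continuousOn fun ζ hζ => ?_
      obtain ⟨z, hz, rfl⟩ := hbij.surjOn (closedBall_subset_ball hr hζ)
      exact (hbij.injOn.continuousAt_invFunOn hopen hd hz).continuousWithinAt
    have hKG : K ⊆ domainG R := by
      rintro _ ⟨ζ, hζ, rfl⟩
      exact Function.invFunOn_mem (hbij.surjOn (closedBall_subset_ball hr hζ))
    have hout : ∀ᶠ t in comap (norm : ℂ → ℝ) (𝓝 1), psiMap R (lambdaMap μ t) ∉ K := by
      refine eventually_comap_norm fun z hz => ?_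
      obtain ⟨hb, hb1⟩ := annulus_bounds h0 h1 (t := z) (by rw [hz]; nlinarith) hz.le
      refine (hasDerivAt_psiMap_lambdaMap h0 hR hb hb1).continuousAt.eventually
        (hKc.isClosed.isOpen_compl.mem_nhds fun h => ?_)
      have h2 := hKG h
      rw [domainG_eq h0 h1 hR] at h2
      exact disjoint_left.1 (curveL_inter_coveredDomain h0 h1 hR)
        (psiMap_lambdaMap_mem_curveL h0 h1 hR hz) h2
    filter_upwards [hA, comap_norm_le hout] with t ht ht2
    by_contra! h
    refine ht2 ⟨φ (psiMap R (lambdaMap μ t)), by simpa using h, ?_⟩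
    exact hbij.injOn.leftInvOn_invFunOn (hin t ht)
  · filter_upwards [hA] with t ht
    have := hbij.mapsTo (hin t ht)
    rw [mem_ball_zero_iff] at this
    linarith

omit h1 in
/-- The critical value of the covering. -/
lemma psiMap_lambdaMap_sub_critical (h1 : μ < 1) {t : ℂ} (ht : t ∈ openAnnulus μ) :
    psiMap R (lambdaMap μ t) - psiMap R (lambdaMap μ μ) = (t - μ) ^ 2 *
      ((1 + μ ^ 2) ^ 2 / (μ * (μ * t - 1) * (t - μ ^ 3))) := by
  obtain ⟨hb, hb1⟩ := annulus_bounds h0 h1 ht.1.le ht.2.le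
  have hμ : (μ : ℂ) ≠ 0 := by exact_mod_cast h0.ne'
  have h3 := sub_pow_ne_zero h0 hb
  have h4 := mul_sub_one_ne_zero h0 hb1
  have h5 : psiMap R (lambdaMap μ μ) = -2 := by
    simp [psiMap, lambdaMap]
    norm_num
  rw [psiMap_lambdaMap h0 hR h4, h5, joukParam, one_div_div]
  generalize hd : (μ : ℂ) * t - 1 = d at h4 ⊢
  field_simp
  rw [← hd]
  ring

/-- A conformal map of the domain onto the disc is given by a quotient of theta functions. -/
lemma exists_eq_thetaQuot {φ : ℂ → ℂ} (hφ : ConformalOnto φ (domainG R) (ball 0 1)) :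
    ∃ a c : ℂ, ‖a‖ < 1 ∧ ‖c‖ = 1 ∧ ∀ t ∈ openAnnulus μ,
      (φ (psiMap R (lambdaMap μ t)) - a) * (t * thetaDen μ t ^ 2) =
        c * thetaNum μ t ^ 2 * (1 - conj a * φ (psiMap R (lambdaMap μ t))) := by
  have hlimφ := tendsto_norm_conformal h0 h1 hR hφ
  obtain ⟨hd, hbij⟩ := hφ
  have hopen : IsOpen (domainG R) := by
    rw [domainG_eq h0 h1 hR]
    exact isOpen_coveredDomain h0 h1 hR
  have hin : ∀ t ∈ openAnnulus μ, psiMap R (lambdaMap μ t) ∈ domainG R := fun t ht => by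
    rw [domainG_eq h0 h1 hR]
    exact mem_image_of_mem _ ht
  have hm : (μ : ℂ) ∈ openAnnulus μ := by
    simp only [openAnnulus, mem_ofPred_eq, Complex.norm_real, Real.norm_eq_abs, abs_of_pos h0]
    exact ⟨by nlinarith, h1⟩
  have hμ : (μ : ℂ) ≠ 0 := by exact_mod_cast h0.ne'
  -- p is the value at the branch point μ. Normalising φ to vanish there creates the double zero
  -- that `thetaNum` squared has.
  set p := psiMap R (lambdaMap μ μ) with hp
  set a := φ p with ha_def
  have hpG : p ∈ domainG R := hin _ hm
  have hball : ∀ z ∈ domainG R, ‖φ z‖ < 1 := fun z hz => by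
    simpa using hbij.mapsTo hz
  have ha : ‖a‖ < 1 := hball _ hpG
  have hden : ∀ z ∈ domainG R, 1 - conj a * φ z ≠ 0 := fun z hz =>
    one_sub_conj_mul_ne_zero ha (hball z hz).le
  set g : ℂ → ℂ := fun z => (φ z - a) / (1 - conj a * φ z) with hg
  have hgd : DifferentiableOn ℂ g (domainG R) :=
    (hd.sub_const a).div ((hd.const_mul _).const_sub 1) hden
  have haa : 1 - conj a * a ≠ 0 := one_sub_conj_mul_ne_zero ha ha.le
  have hginj : InjOn g (domainG R) := by
    intro z hz w hw h
    refine hbij.injOn hz hw ?_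
    simp only [hg] at h
    rw [div_eq_div_iff (hden z hz) (hden w hw)] at h
    refine sub_eq_zero.1 ((mul_eq_zero.1 ?_).resolve_left haa)
    linear_combination h
  have hgp : g p = 0 := by simp [hg, ha_def]
  -- Univalence makes p the only zero of g, and a simple one, so k has no zeros.
  set k : ℂ → ℂ := dslope g p with hk
  have hkd : DifferentiableOn ℂ k (domainG R) :=
    (Complex.differentiableOn_dslope (hopen.mem_nhds hpG)).2 hgd
  have hgk : ∀ z, g z = (z - p) * k z := fun z => by
    have := sub_smul_dslope g p z
    rw [hgp, sub_zero, smul_eq_mul] at this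
    exact this.symm
  have hk0 : ∀ z ∈ domainG R, k z ≠ 0 := by
    intro z hz h
    by_cases hzp : z = p
    · rw [hzp, hk, dslope_same] at h
      exact hginj.deriv_ne_zero hopen hgd hpG h
    · refine hzp (hginj hz hpG ?_)
      rw [hgp, hgk, h, mul_zero]
  set κ : ℂ → ℂ := fun t => (1 + μ ^ 2) ^ 2 / (μ * (μ * t - 1) * (t - μ ^ 3)) with hκ
  -- The ratio of the normalised map to the theta quotient, with the common factor (t - μ)² already
  -- cancelled; hence Q is holomorphic and nonzero at μ as well.
  set Q : ℂ → ℂ := fun t => κ t * k (psiMap R (lambdaMap μ t)) * (t * thetaDen μ t ^ 2) /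
    thetaNumFactor μ t ^ 2 with hQ
  have hne : ∀ t ∈ openAnnulus μ, t ≠ 0 := fun t ht =>
    norm_pos_iff.1 (lt_trans (by positivity) ht.1)
  have hκden : ∀ t ∈ openAnnulus μ, (μ : ℂ) * (μ * t - 1) * (t - μ ^ 3) ≠ 0 := fun t ht => by
    obtain ⟨hb, hb1⟩ := annulus_bounds h0 h1 ht.1.le ht.2.le
    exact mul_ne_zero (mul_ne_zero hμ (mul_sub_one_ne_zero h0 hb1)) (sub_pow_ne_zero h0 hb)
  have hμ2 : (1 + (μ : ℂ) ^ 2) ^ 2 ≠ 0 := by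
    have : (1 + μ ^ 2) ^ 2 ≠ 0 := by positivity
    exact_mod_cast this
  have hQ0 : ∀ t ∈ openAnnulus μ, Q t ≠ 0 := fun t ht =>
    div_ne_zero (mul_ne_zero (mul_ne_zero (div_ne_zero hμ2 (hκden t ht)) (hk0 _ (hin t ht)))
      (mul_ne_zero (hne t ht) (pow_ne_zero 2 (thetaDen_ne_zero h0 h1 ht.1 ht.2.le))))
      (pow_ne_zero 2 (thetaNumFactor_ne_zero h0 h1 ht.1 ht.2))
  have hQd : DifferentiableOn ℂ Q (openAnnulus μ) := by
    intro t ht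
    obtain ⟨hb, hb1⟩ := annulus_bounds h0 h1 ht.1.le ht.2.le
    have d1 : DifferentiableAt ℂ κ t :=
      DifferentiableAt.div (by fun_prop) (by fun_prop) (hκden t ht)
    have d2 : DifferentiableAt ℂ (fun t => k (psiMap R (lambdaMap μ t))) t :=
      (hkd.differentiableAt (hopen.mem_nhds (hin t ht))).comp t
        (hasDerivAt_psiMap_lambdaMap h0 hR hb hb1).differentiableAt
    have d3 := differentiableAt_thetaDen h0 h1 (hne t ht)
    have d4 := differentiableAt_thetaNumFactor h0 h1 (hne t ht)
    exact (((d1.mul d2).mul (differentiableAt_id.mul (d3.pow 2))).div (d4.pow 2)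
      (pow_ne_zero 2 (thetaNumFactor_ne_zero h0 h1 ht.1 ht.2))).differentiableWithinAt
  have hrel : ∀ t ∈ openAnnulus μ,
      g (psiMap R (lambdaMap μ t)) * (t * thetaDen μ t ^ 2) = Q t * thetaNum μ t ^ 2 := by
    intro t ht
    have hf := thetaNumFactor_ne_zero h0 h1 ht.1 ht.2
    rw [hgk, psiMap_lambdaMap_sub_critical h0 hR h1 ht, thetaNum_eq_mul h0 h1]
    simp only [hQ, hκ]
    field_simp
  have hnum : ∀ t ∈ openAnnulus μ, t ≠ μ → thetaNum μ t ≠ 0 := fun t ht htμ => by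
    rw [thetaNum_eq_mul h0 h1]
    exact mul_ne_zero (sub_ne_zero.2 htμ) (thetaNumFactor_ne_zero h0 h1 ht.1 ht.2)
  have hsymm : ∀ t ∈ openAnnulus μ, Q (μ ^ 2 / t) = Q t := by
    intro t ht
    by_cases htμ : t = μ
    · rw [htμ]
      congr 1
      field_simp
    have ht0 := hne t ht
    have e := hrel _ (sq_div_annulus h0 ht.1 ht.2)
    obtain ⟨hb, hb1⟩ := annulus_bounds h0 h1 ht.1.le ht.2.le
    rw [psiMap_lambdaMap_sq_div h0 hR hb hb1, thetaDen_sq_div h0 ht0,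
      thetaNum_sq_div h0 h1 ht0] at e
    have e2 := hrel t ht
    refine mul_right_cancel₀ (pow_ne_zero 2 (hnum t ht htμ)) ?_
    rw [← e2]
    field_simp at e
    linear_combination -e
  have hlim : Tendsto (fun t => ‖Q t‖) (comap (norm : ℂ → ℝ) (𝓝[<] 1)) (𝓝 1) := by
    have l1 := tendsto_norm_mobius ha hlimφ
    have l2 := (tendsto_norm_thetaQuot h0 h1).mono_left comap_norm_le
    have l3 := l1.div l2 one_ne_zero
    rw [div_one] at l3
    refine l3.congr' ?_
    have hgt : ∀ᶠ t in comap (norm : ℂ → ℝ) (𝓝[<] 1), μ < ‖t‖ :=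
      ((eventually_gt_nhds h1).filter_mono inf_le_left).comap _
    filter_upwards [eventually_mem_openAnnulus h0 h1, hgt] with t ht htμ
    have hn := hnum t ht (fun h => by
      rw [h, Complex.norm_real, Real.norm_eq_abs, abs_of_pos h0] at htμ
      exact lt_irrefl _ htμ)
    have ht0 := hne t ht
    have hdn := thetaDen_ne_zero h0 h1 ht.1 ht.2.le
    rw [Pi.div_apply, ← norm_div]
    congr 1
    rw [div_div_eq_mul_div, div_eq_iff (pow_ne_zero 2 hn)]
    exact hrel t ht
  have hle := norm_le_one_of_tendsto h0 hQd hsymm hlim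
  -- The same bound for 1/Q gives |Q| = 1 throughout, so Q is constant by the maximum modulus
  -- theorem.
  have hge := norm_le_one_of_tendsto (Q := Q⁻¹) h0 (hQd.inv hQ0)
    (fun t ht => by simp only [Pi.inv_apply, hsymm t ht])
    (by simpa only [Pi.inv_apply, norm_inv, inv_one] using hlim.inv₀ one_ne_zero)
  have hone : ∀ t ∈ openAnnulus μ, ‖Q t‖ = 1 := fun t ht => by
    refine le_antisymm (hle t ht) ?_
    have := hge t ht
    rw [Pi.inv_apply, norm_inv] at this
    exact (inv_le_one₀ (norm_pos_iff.2 (hQ0 t ht))).1 this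
  have hconst := Complex.eqOn_of_isPreconnected_of_isMaxOn_norm (isPreconnected_openAnnulus μ)
    (isOpen_openAnnulus μ) hQd hm (fun t ht => by
      simp only [mem_ofPred_eq, Function.comp]
      rw [hone t ht, hone _ hm])
  refine ⟨a, Q μ, ha, hone _ hm, fun t ht => ?_⟩
  have e := hrel t ht
  rw [hconst ht, Function.const_apply] at e
  simp only [hg] at e
  have := hden _ (hin t ht)
  rw [div_mul_eq_mul_div, div_eq_iff this] at e
  rw [e]

end

/-! ### The extension H to the punctured plane: symmetries and distribution of values. -/

section
open Set Metric Filter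

/-- `H` continues `φ ∘ ψ ∘ λ` to a meromorphic function on the punctured plane compatible with the
deck transformation of the covering and with the reflection about the unit circle. -/
structure IsAnnulusExtension (R μ : ℝ) (φ : ℂ → ℂ) (H : ℂ → OnePoint ℂ) : Prop where
  meromorphic : ∀ t, t ≠ 0 → SphereMeromorphicAt H t
  sq_div : ∀ t, t ≠ 0 → H (μ ^ 2 / t) = H t
  conj_inv : ∀ t, t ≠ 0 → H (conj t)⁻¹ = sphereReflect (H t)
  eq_coe : ∀ t ∈ openAnnulus μ, H t = (φ (psiMap R (lambdaMap μ t)) : OnePoint ℂ)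

lemma isPreconnected_compl_zero : IsPreconnected ({0}ᶜ : Set ℂ) := by
  refine (isConnected_compl_singleton_of_one_lt_rank ?_ 0).isPreconnected
  rw [Complex.rank_real_complex]
  norm_num

/-- Solve the theta relation for φ to get N/D. Its coefficient determinant is a nonzero multiple of
1 - |a|², so N and D vanish together only if both theta functions do. Each symmetry multiplies the
homogeneous coordinates by a common factor. -/
lemma exists_isAnnulusExtension {R μ : ℝ} (h0 : 0 < μ) (h1 : μ < 1) (hR : R * μ = μ ^ 2 + 1)
    {φ : ℂ → ℂ} (hφ : ConformalOnto φ (domainG R) (ball 0 1)) :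
    ∃ H, IsAnnulusExtension R μ φ H := by
  obtain ⟨a, c, ha, hc, hrel⟩ := exists_eq_thetaQuot h0 h1 hR hφ
  have hc0 : c ≠ 0 := norm_pos_iff.1 (by rw [hc]; exact one_pos)
  have hcc : conj c * c = 1 := by
    rw [mul_comm, Complex.mul_conj, Complex.normSq_eq_norm_sq, hc]
    simp
  have haa : (1 : ℂ) - conj a * a ≠ 0 := one_sub_conj_mul_ne_zero ha ha.le
  have hμ : (μ : ℂ) ≠ 0 := by exact_mod_cast h0.ne'
  set N : ℂ → ℂ := fun t => c * thetaNum μ t ^ 2 + a * (t * thetaDen μ t ^ 2) with hN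
  set D : ℂ → ℂ := fun t => t * thetaDen μ t ^ 2 + conj a * (c * thetaNum μ t ^ 2) with hD
  have hND : ∀ t, t ≠ 0 → N t = 0 → D t ≠ 0 := by
    intro t ht hn hd
    simp only [hN, hD] at hn hd
    have e1 : (1 - conj a * a) * (t * thetaDen μ t ^ 2) = 0 := by
      linear_combination hd - conj a * hn
    have e2 : t * thetaDen μ t ^ 2 = 0 := (mul_eq_zero.1 e1).resolve_left haa
    have e3 : c * thetaNum μ t ^ 2 = 0 := by linear_combination hn - a * e2
    exact thetaNum_thetaDen_not_both_zero h0 h1 ht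
      (pow_eq_zero_iff two_ne_zero |>.1 ((mul_eq_zero.1 e3).resolve_left hc0))
      (pow_eq_zero_iff two_ne_zero |>.1 ((mul_eq_zero.1 e2).resolve_left ht))
  have hdN : DifferentiableOn ℂ N {0}ᶜ := fun t ht =>
    ((((differentiableAt_thetaNum h0 h1 ht).pow 2).const_mul c).add
      ((differentiableAt_id.mul ((differentiableAt_thetaDen h0 h1 ht).pow 2)).const_mul
        a)).differentiableWithinAt
  have hdD : DifferentiableOn ℂ D {0}ᶜ := fun t ht =>
    ((differentiableAt_id.mul ((differentiableAt_thetaDen h0 h1 ht).pow 2)).add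
      ((((differentiableAt_thetaNum h0 h1 ht).pow 2).const_mul c).const_mul
        (conj a))).differentiableWithinAt
  have hpos : ∀ t ∈ openAnnulus μ, t ≠ 0 := fun t ht =>
    norm_pos_iff.1 (lt_trans (by positivity) ht.1)
  have hDA : ∀ t ∈ openAnnulus μ, D t ≠ 0 := by
    intro t ht hd
    have e := hrel t ht
    simp only [hD] at hd
    have e1 : (1 - conj a * a) * (c * thetaNum μ t ^ 2) = 0 := by
      linear_combination -e + (φ (psiMap R (lambdaMap μ t)) - a) * hd
    have e3 := (mul_eq_zero.1 e1).resolve_left haa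
    have e2 : t * thetaDen μ t ^ 2 = 0 := by linear_combination hd - conj a * e3
    exact mul_ne_zero (hpos t ht) (pow_ne_zero 2 (thetaDen_ne_zero h0 h1 ht.1 ht.2.le)) e2
  have hm : (μ : ℂ) ∈ openAnnulus μ := by
    simp only [openAnnulus, mem_ofPred_eq, Complex.norm_real, Real.norm_eq_abs, abs_of_pos h0]
    exact ⟨by nlinarith, h1⟩
  refine ⟨fun t => sphereQuot (N t) (D t), ⟨?_, ?_, ?_, ?_⟩⟩
  · intro t ht
    have hnhds : ({0}ᶜ : Set ℂ) ∈ 𝓝 t := isOpen_compl_singleton.mem_nhds ht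
    refine sphereMeromorphicAt_sphereQuot (hdN.analyticAt hnhds) (hdD.analyticAt hnhds)
      (hND t ht) ?_
    -- D is not identically zero, as D(μ) ≠ 0, so its zeros are isolated by the identity theorem on
    -- ℂ ∖ {0}.
    refine (hdD.analyticAt hnhds).eventually_eq_zero_or_eventually_ne_zero.resolve_left fun h => ?_
    have := (hdD.analyticOnNhd isOpen_compl_singleton).eqOn_zero_of_preconnected_of_eventuallyEq_zero
      isPreconnected_compl_zero ht h
    exact hDA _ hm (this hμ)
  · intro t ht
    have hx : (μ : ℂ) ^ 2 / t ^ 2 ≠ 0 := div_ne_zero (pow_ne_zero 2 hμ) (pow_ne_zero 2 ht)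
    rw [← sphereQuot_mul hx (N t)]
    simp only [hN, hD]
    rw [thetaNum_sq_div h0 h1 ht, thetaDen_sq_div h0 ht]
    congr 1 <;> · field_simp
  · intro t ht
    have ht' : conj t ≠ 0 := (map_ne_zero _).2 ht
    rw [sphereReflect_sphereQuot (hND t ht),
      ← sphereQuot_mul (div_ne_zero hc0 (pow_ne_zero 3 ht')) (conj (D t))]
    simp only [hN, hD]
    simp only [map_add, map_mul, map_pow, Complex.conj_conj, conj_thetaNum h0 h1,
      conj_thetaDen h0 h1]
    rw [thetaNum_inv h0 h1 ht', thetaDen_inv h0 h1 ht']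
    have e : ∀ x : ℂ, c / conj t ^ 3 * (conj c * x) = x / conj t ^ 3 := fun x => by
      rw [div_mul_eq_mul_div, ← mul_assoc, mul_comm c, hcc, one_mul]
    congr 1
    · rw [mul_add, mul_left_comm _ a, e]
      field_simp
    · rw [mul_add, e]
      field_simp
  · intro t ht
    rw [sphereQuot_of_ne (hDA t ht), OnePoint.coe_eq_coe, div_eq_iff (hDA t ht)]
    simp only [hN, hD]
    linear_combination -hrel t ht

namespace IsAnnulusExtension

variable {R μ : ℝ} {φ : ℂ → ℂ} {H : ℂ → OnePoint ℂ} (hH : IsAnnulusExtension R μ φ H)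
  (h0 : 0 < μ) (h1 : μ < 1) (hR : R * μ = μ ^ 2 + 1)
  (hφ : ConformalOnto φ (domainG R) (ball 0 1))

section
include hH h0

omit h0 in
-- Composing t ↦ 1/conj t with t ↦ μ²/t gives t ↦ μ² conj t. Its square is dilation by μ⁴, under
-- which H is therefore invariant.
lemma sq_mul_conj {t : ℂ} (ht : t ≠ 0) : H (μ ^ 2 * conj t) = sphereReflect (H t) := by
  have ht' : conj t ≠ 0 := (map_ne_zero _).2 ht
  rw [← hH.conj_inv t ht, ← hH.sq_div _ (inv_ne_zero ht'), div_inv_eq_mul]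

lemma pow_four_mul {t : ℂ} (ht : t ≠ 0) : H (μ ^ 4 * t) = H t := by
  have hμ : (μ : ℂ) ≠ 0 := by exact_mod_cast h0.ne'
  have h2 : (μ : ℂ) ^ 2 * conj t ≠ 0 := mul_ne_zero (pow_ne_zero 2 hμ) ((map_ne_zero _).2 ht)
  have := hH.sq_mul_conj h2
  rw [hH.sq_mul_conj ht, sphereReflect_sphereReflect] at this
  rw [← this]
  congr 1
  simp only [map_mul, map_pow, Complex.conj_ofReal, Complex.conj_conj]
  ring

lemma zpow_mul {t : ℂ} (ht : t ≠ 0) (n : ℤ) : H ((μ : ℂ) ^ (4 * n) * t) = H t := by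
  have hμ : (μ : ℂ) ≠ 0 := by exact_mod_cast h0.ne'
  induction n using Int.induction_on with
  | zero => simp
  | succ n ih =>
    rw [← ih, ← hH.pow_four_mul h0 (mul_ne_zero (zpow_ne_zero (4 * (n : ℤ)) hμ) ht), mul_add,
      zpow_add₀ hμ, show (μ : ℂ) ^ (4 * (1 : ℤ)) = μ ^ 4 by norm_cast]
    congr 1
    ring
  | pred n ih =>
    rw [← ih, ← hH.pow_four_mul h0 (mul_ne_zero (zpow_ne_zero _ hμ) ht), ← mul_assoc]
    congr 2
    rw [← zpow_natCast, ← zpow_add₀ hμ]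
    congr 1
    push_cast
    ring

lemma eq_of_even {t : ℂ} (ht : t ≠ 0) {k : ℤ} (hk : Even k) :
    H t = H (t / (μ : ℂ) ^ (2 * k)) := by
  obtain ⟨j, rfl⟩ := hk
  rw [← hH.zpow_mul h0 ht (-j), div_eq_mul_inv, mul_comm t, ← zpow_neg]
  congr 3
  ring

lemma eq_of_odd {t : ℂ} (ht : t ≠ 0) {k : ℤ} (hk : Odd k) :
    H t = sphereReflect (H (conj t / (μ : ℂ) ^ (2 * k))) := by
  have hμ : (μ : ℂ) ≠ 0 := by exact_mod_cast h0.ne'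
  obtain ⟨j, rfl⟩ := hk
  have ht' : conj t ≠ 0 := (map_ne_zero _).2 ht
  rw [← hH.sq_mul_conj (div_ne_zero ht' (zpow_ne_zero _ hμ)), ← hH.zpow_mul h0 ht (-j)]
  have e : (μ : ℂ) ^ (4 * -j) = μ ^ 2 * ((μ : ℂ) ^ (2 * (2 * j + 1)))⁻¹ := by
    rw [← zpow_neg, ← zpow_natCast (μ : ℂ) 2, ← zpow_add₀ hμ]
    congr 1
    push_cast
    ring
  rw [e, map_div₀, map_zpow₀, Complex.conj_conj, Complex.conj_ofReal, div_eq_mul_inv]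
  congr 1
  ring

end

section
include hH

/-- Points of the unit circle are fixed by t ↦ 1/conj t, so their values are fixed by the
reflection. -/
lemma unimodular {t : ℂ} (ht : ‖t‖ = 1) : ∃ ζ : ℂ, ‖ζ‖ = 1 ∧ H t = ζ := by
  have ht0 : t ≠ 0 := norm_pos_iff.1 (by rw [ht]; exact one_pos)
  refine exists_norm_eq_one_of_sphereReflect_eq ?_
  rw [← hH.conj_inv t ht0]
  congr 1
  rw [Complex.inv_def, Complex.conj_conj, Complex.normSq_eq_norm_sq, RCLike.norm_conj, ht]
  simp

include h0 in
lemma unimodular_sq {t : ℂ} (ht : μ ^ 2 * ‖t‖ = 1) : ∃ ζ : ℂ, ‖ζ‖ = 1 ∧ H t = ζ := by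
  have ht0 : t ≠ 0 := by
    rintro rfl
    simp at ht
  have hμ : (μ : ℂ) ≠ 0 := by exact_mod_cast h0.ne'
  have h2 : ((μ : ℂ) ^ 2 * t) ≠ 0 := mul_ne_zero (pow_ne_zero 2 hμ) ht0
  have hn : ‖(μ : ℂ) ^ 2 * t‖ = 1 := by
    rw [norm_mul, norm_pow, Complex.norm_real, Real.norm_eq_abs, abs_of_pos h0, ht]
  have hc : conj ((μ : ℂ) ^ 2 * t) ≠ 0 := (map_ne_zero _).2 h2
  have := hH.sq_mul_conj hc
  rw [Complex.conj_conj, ← mul_assoc, ← pow_add, hH.pow_four_mul h0 ht0, ← hH.conj_inv _ hc] at this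
  rw [this]
  exact hH.unimodular (by rw [norm_inv, Complex.conj_conj, hn, inv_one])

include h0 h1 hR hφ

omit hH hφ in
lemma mem_domainG {t : ℂ} (ht : t ∈ openAnnulus μ) : psiMap R (lambdaMap μ t) ∈ domainG R := by
  rw [domainG_eq h0 h1 hR]
  exact mem_image_of_mem _ ht

lemma exists_disc {t : ℂ} (ht : t ∈ openAnnulus μ) : ∃ ζ : ℂ, ‖ζ‖ < 1 ∧ H t = ζ :=
  ⟨_, mem_ball_zero_iff.1 (hφ.2.mapsTo (mem_domainG h0 h1 hR ht)), hH.eq_coe t ht⟩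

omit hH hR hφ in
lemma norm_conj_inv_mem {t : ℂ} (ht : 1 < ‖t‖) (ht1 : μ ^ 2 * ‖t‖ < 1) :
    (conj t)⁻¹ ∈ openAnnulus μ := by
  have hp : 0 < ‖t‖ := by linarith
  change ‖(conj t)⁻¹‖ ∈ Ioo (μ ^ 2) 1
  rw [norm_inv, RCLike.norm_conj]
  exact ⟨by rwa [lt_inv_comm₀ (by positivity) hp, ← one_div, lt_div_iff₀ (by positivity), mul_comm],
    inv_lt_one_of_one_lt₀ ht⟩

lemma exists_reflect {t : ℂ} (ht : 1 < ‖t‖) (ht1 : μ ^ 2 * ‖t‖ < 1) :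
    ∃ ζ : ℂ, ‖ζ‖ < 1 ∧ H t = sphereReflect ζ := by
  have ht0 : t ≠ 0 := norm_pos_iff.1 (by linarith)
  obtain ⟨ζ, hζ, h⟩ := hH.exists_disc h0 h1 hR hφ (norm_conj_inv_mem h0 h1 ht ht1)
  refine ⟨ζ, hζ, ?_⟩
  rw [← h, hH.conj_inv t ht0, sphereReflect_sphereReflect]

/-- In the fundamental annulus, the values in the disc are taken only for `|t| < 1`. -/
lemma norm_lt_one_of_eq {t ζ : ℂ} (ht1 : μ ^ 2 * ‖t‖ ≤ 1) (hζ : ‖ζ‖ < 1)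
    (h : H t = ζ) : ‖t‖ < 1 := by
  by_contra! h2
  rcases h2.eq_or_lt with h2 | h2
  · obtain ⟨ξ, hξ, h3⟩ := hH.unimodular h2.symm
    rw [h, OnePoint.coe_eq_coe] at h3
    rw [h3, hξ] at hζ
    exact lt_irrefl _ hζ
  · rcases ht1.eq_or_lt with h3 | h3
    · obtain ⟨ξ, hξ, h3⟩ := hH.unimodular_sq h0 h3
      rw [h, OnePoint.coe_eq_coe] at h3
      rw [h3, hξ] at hζ
      exact lt_irrefl _ hζ
    · obtain ⟨ξ, hξ, h4⟩ := hH.exists_reflect h0 h1 hR hφ h2 h3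
      have := sphereReflect_coe_eq_coe (h4.symm.trans h)
      nlinarith [norm_nonneg ζ, norm_nonneg ξ]

lemma eq_iff_of_mem {s t : ℂ} (hs : s ∈ openAnnulus μ) (ht : t ∈ openAnnulus μ) :
    H s = H t ↔ s = t ∨ s = μ ^ 2 / t := by
  obtain ⟨hs1, hs2⟩ := annulus_bounds h0 h1 hs.1.le hs.2.le
  obtain ⟨ht1, ht2⟩ := annulus_bounds h0 h1 ht.1.le ht.2.le
  rw [← psiMap_lambdaMap_eq_iff h0 h1 hR hs1 hs2 ht1 ht2, hH.eq_coe s hs, hH.eq_coe t ht,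
    OnePoint.coe_eq_coe]
  exact hφ.2.injOn.eq_iff (mem_domainG h0 h1 hR hs) (mem_domainG h0 h1 hR ht)

omit hH h1 hR hφ in
lemma norm_pow_mul (k : ℕ) (t : ℂ) : ‖(μ : ℂ) ^ k * t‖ = μ ^ k * ‖t‖ := by
  rw [norm_mul, norm_pow, Complex.norm_real, Real.norm_eq_abs, abs_of_pos h0]

/-- The period μ⁴ moves a solution into μ² < |s| ≤ μ⁻². There a value in the disc forces |s| < 1, so
s lies in the annulus and equals t₀ or μ²/t₀. -/
lemma solutions {t₀ : ℂ} (ht₀ : t₀ ∈ openAnnulus μ) :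
    {t : ℂ | 0 < ‖t‖ ∧ ‖t‖ < 1 ∧ H t = H t₀} =
      Set.range (fun k : ℕ => (μ : ℂ) ^ (4 * k) * t₀) ∪
        Set.range (fun k : ℕ => (μ : ℂ) ^ (4 * k + 2) / t₀) := by
  have hμ : (μ : ℂ) ≠ 0 := by exact_mod_cast h0.ne'
  have hne : ∀ t ∈ openAnnulus μ, t ≠ 0 := fun t ht =>
    norm_pos_iff.1 (lt_trans (by positivity) ht.1)
  have hback : ∀ s ∈ openAnnulus μ, H s = H t₀ → ∀ k : ℕ, (μ : ℂ) ^ (4 * k) * s ∈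
      {t : ℂ | 0 < ‖t‖ ∧ ‖t‖ < 1 ∧ H t = H t₀} := by
    intro s hs hst k
    have hs0 := norm_pos_iff.2 (hne s hs)
    have hk := pow_le_one₀ h0.le h1.le (n := 4 * k)
    have hk0 := pow_pos h0 (4 * k)
    refine ⟨?_, ?_, ?_⟩
    · rw [norm_pow_mul h0]
      positivity
    · rw [norm_pow_mul h0]
      nlinarith [hs.2]
    · rw [← hst, ← hH.zpow_mul h0 (hne s hs) k]
      congr 2
  have hshift : ∀ k : ℕ, (μ : ℂ) ^ (4 * k + 2) / t₀ = (μ : ℂ) ^ (4 * k) * (μ ^ 2 / t₀) :=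
    fun k => by rw [pow_add, mul_div_assoc]
  ext t
  constructor
  · rintro ⟨htp, ht1, htH⟩
    have ht0 : t ≠ 0 := norm_pos_iff.1 htp
    -- With m = n + 1 and s = μ^(4m) t this gives μ⁴ < μ²|s| ≤ 1.
    obtain ⟨n, hn1, hn2⟩ := exists_mem_Ioc_zpow (x := μ ^ 2 * ‖t‖) (y := (μ ^ 4)⁻¹) (by positivity)
      (one_lt_inv_iff₀.2 ⟨by positivity, pow_four_lt_one h0 h1⟩)
    set m : ℤ := n + 1 with hm
    have hinv : ∀ j : ℤ, ((μ ^ 4)⁻¹) ^ j * μ ^ (4 * j) = 1 := fun j => by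
      rw [inv_zpow, _root_.zpow_mul, ← zpow_natCast μ 4]
      exact inv_mul_cancel₀ (zpow_ne_zero _ (zpow_ne_zero _ h0.ne'))
    have hzp : 0 < μ ^ (4 * m) := zpow_pos h0 _
    set s : ℂ := (μ : ℂ) ^ (4 * m) * t with hs
    have hsn : ‖s‖ = μ ^ (4 * m) * ‖t‖ := by
      rw [hs, norm_mul, norm_zpow, Complex.norm_real, Real.norm_eq_abs, abs_of_pos h0]
    have hsH : H s = H t₀ := by rw [hs, hH.zpow_mul h0 ht0, htH]
    have hs1 : μ ^ 2 * ‖s‖ ≤ 1 := by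
      rw [hsn, ← hinv m]
      nlinarith [mul_le_mul_of_nonneg_right hn2 hzp.le]
    have hs2 : μ ^ 2 < ‖s‖ := by
      have h5 := mul_lt_mul_of_pos_right hn1 hzp
      have h6 : ((μ ^ 4)⁻¹) ^ n * μ ^ (4 * m) = μ ^ 4 := by
        rw [hm, mul_add, zpow_add₀ h0.ne', ← mul_assoc, hinv n]
        norm_cast
        ring
      rw [h6] at h5
      have h7 : μ ^ 2 * μ ^ 2 < μ ^ 2 * ‖s‖ := by
        rw [hsn]
        nlinarith
      exact lt_of_mul_lt_mul_left h7 (by positivity)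
    obtain ⟨ζ, hζ, hζH⟩ := hH.exists_disc h0 h1 hR hφ ht₀
    have hsA : s ∈ openAnnulus μ :=
      ⟨hs2, hH.norm_lt_one_of_eq h0 h1 hR hφ hs1 hζ (hsH.trans hζH)⟩
    -- Since |t| < 1, a positive m would give |s| ≤ μ⁴ < μ². Hence only nonnegative powers of μ⁴
    -- occur.
    have hm0 : m ≤ 0 := by
      by_contra! hm1
      have h8 : μ ^ (4 * m) ≤ μ ^ (4 : ℤ) := zpow_le_zpow_right_of_le_one₀ h0 h1.le (by omega)
      have h9 : μ ^ (4 : ℤ) = μ ^ 4 := by norm_cast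
      rw [h9] at h8
      have h10 : ‖s‖ ≤ μ ^ 4 := by
        rw [hsn]
        nlinarith
      nlinarith [pow_le_pow_of_le_one h0.le h1.le (show 2 ≤ 4 by norm_num)]
    obtain ⟨k, hk⟩ := Int.eq_ofNat_of_zero_le (neg_nonneg.2 hm0)
    have hts : t = (μ : ℂ) ^ (4 * k) * s := by
      rw [hs, ← mul_assoc, ← zpow_natCast, ← zpow_add₀ hμ]
      rw [show ((4 * k : ℕ) : ℤ) + 4 * m = 0 by push_cast; omega, zpow_zero, one_mul]
    rcases (hH.eq_iff_of_mem h0 h1 hR hφ hsA ht₀).1 hsH with h | h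
    · exact Or.inl ⟨k, by rw [hts, h]⟩
    · exact Or.inr ⟨k, by rw [hts, h]; exact hshift k⟩
  · rintro (⟨k, rfl⟩ | ⟨k, rfl⟩)
    · exact hback t₀ ht₀ rfl k
    · dsimp only
      rw [hshift]
      exact hback _ (sq_div_annulus h0 ht₀.1 ht₀.2) (hH.sq_div t₀ (hne t₀ ht₀)) k

/-- Every point of the sphere is a value. -/
lemma surjective (c : OnePoint ℂ) : ∃ t : ℂ, t ≠ 0 ∧ H t = c := by
  have hne : ∀ t ∈ openAnnulus μ, t ≠ 0 := fun t ht =>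
    norm_pos_iff.1 (lt_trans (by positivity) ht.1)
  have hdisc : ∀ ζ : ℂ, ‖ζ‖ < 1 → ∃ t ∈ openAnnulus μ, H t = ζ := by
    intro ζ hζ
    obtain ⟨z, hz, rfl⟩ := hφ.2.surjOn (mem_ball_zero_iff.2 hζ)
    rw [domainG_eq h0 h1 hR] at hz
    obtain ⟨t, ht, rfl⟩ := hz
    exact ⟨t, ht, hH.eq_coe t ht⟩
  rcases sphere_trichotomy c with ⟨ζ, hζ, rfl⟩ | ⟨ζ, hζ, rfl⟩ | ⟨ζ, hζ, rfl⟩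
  · obtain ⟨t, ht, h⟩ := hdisc ζ hζ
    exact ⟨t, hne t ht, h⟩
  -- Values on the unit circle come from compactness: the image of the closed annulus is closed and
  -- contains the open disc.
  · have hcomp : IsCompact (H '' closedAnnulus μ) := by
      refine (isCompact_closedAnnulus μ).image_of_continuousOn fun t ht => ?_
      have ht0 : t ≠ 0 := norm_pos_iff.1 (lt_of_lt_of_le (by positivity) ht.1)
      exact (hH.meromorphic t ht0).2.continuousWithinAt
    have hcl : (ζ : OnePoint ℂ) ∈ closure ((fun z : ℂ => (z : OnePoint ℂ)) '' ball 0 1) := by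
      refine ContinuousAt.continuousWithinAt OnePoint.continuous_coe.continuousAt
        |>.mem_closure_image ?_
      rw [closure_ball _ one_ne_zero]
      simp [hζ]
    have hsub : (fun z : ℂ => (z : OnePoint ℂ)) '' ball 0 1 ⊆ H '' closedAnnulus μ := by
      rintro _ ⟨z, hz, rfl⟩
      obtain ⟨t, ht, h⟩ := hdisc z (mem_ball_zero_iff.1 hz)
      exact ⟨t, ⟨ht.1.le, ht.2.le⟩, h⟩
    obtain ⟨t, ht, h⟩ := closure_minimal hsub hcomp.isClosed hcl
    exact ⟨t, norm_pos_iff.1 (lt_of_lt_of_le (by positivity) ht.1), h⟩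
  · obtain ⟨t, ht, h⟩ := hdisc ζ hζ
    have ht0 := hne t ht
    exact ⟨(conj t)⁻¹, inv_ne_zero ((map_ne_zero _).2 ht0), by rw [hH.conj_inv t ht0, h]⟩

lemma exists_small (c : OnePoint ℂ) {ε : ℝ} (hε : 0 < ε) : ∃ t : ℂ, t ≠ 0 ∧ ‖t‖ < ε ∧ H t = c := by
  have hμ : (μ : ℂ) ≠ 0 := by exact_mod_cast h0.ne'
  obtain ⟨t, ht, h⟩ := hH.surjective h0 h1 hR hφ c
  have htp := norm_pos_iff.2 ht
  obtain ⟨k, hk⟩ := exists_pow_lt_of_lt_one (div_pos hε htp) (pow_four_lt_one h0 h1)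
  refine ⟨(μ : ℂ) ^ (4 * k) * t, mul_ne_zero (pow_ne_zero _ hμ) ht, ?_, ?_⟩
  · rw [norm_pow_mul h0, pow_mul]
    exact (lt_div_iff₀ htp).1 hk
  · rw [← h, ← hH.zpow_mul h0 ht k]
    congr 2

/-- Near μ^(4k) t₀, periodicity gives H(t) = φ(ψ(λ(t/μ^(4k)))). The inner factor μ^(-4k) joins the
1/μ from the derivative of ψ ∘ λ. -/
lemma hasDerivAt {t₀ : ℂ} (ht₀ : t₀ ∈ openAnnulus μ) (k : ℕ) :
    SphereHasDerivAt H
      (-(deriv φ (psiMap R (lambdaMap μ t₀)) * (1 - (μ : ℂ) ^ 4) ^ 2 * (t₀ - (μ : ℂ) ^ 2 / t₀) /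
        ((μ : ℂ) ^ (4 * k + 1) * t₀ * (1 - (μ : ℂ) * t₀) ^ 2 * (1 - (μ : ℂ) ^ 3 / t₀) ^ 2)))
      ((μ : ℂ) ^ (4 * k) * t₀) := by
  have hμ : (μ : ℂ) ≠ 0 := by exact_mod_cast h0.ne'
  have hk : (μ : ℂ) ^ (4 * k) ≠ 0 := pow_ne_zero _ hμ
  obtain ⟨hb, hb1⟩ := annulus_bounds h0 h1 ht₀.1.le ht₀.2.le
  have hopen : IsOpen (domainG R) := by
    rw [domainG_eq h0 h1 hR]
    exact isOpen_coveredDomain h0 h1 hR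
  have hval : (μ : ℂ) ^ (4 * k) * t₀ / (μ : ℂ) ^ (4 * k) = t₀ := mul_div_cancel_left₀ _ hk
  refine ⟨fun t => φ (psiMap R (lambdaMap μ (t / (μ : ℂ) ^ (4 * k)))), ?_, ?_⟩
  · have hc : ContinuousAt (fun t : ℂ => t / (μ : ℂ) ^ (4 * k)) ((μ : ℂ) ^ (4 * k) * t₀) := by
      fun_prop
    have hmem : openAnnulus μ ∈ 𝓝 ((μ : ℂ) ^ (4 * k) * t₀ / (μ : ℂ) ^ (4 * k)) := by
      rw [hval]
      exact (isOpen_openAnnulus μ).mem_nhds ht₀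
    filter_upwards [hc hmem] with t ht
    have ht' : t / (μ : ℂ) ^ (4 * k) ∈ openAnnulus μ := ht
    have hne : t / (μ : ℂ) ^ (4 * k) ≠ 0 := norm_pos_iff.1 (lt_trans (by positivity) ht'.1)
    rw [← hH.eq_coe _ ht', ← hH.zpow_mul h0 hne k]
    congr 1
    rw [show (μ : ℂ) ^ (4 * (k : ℤ)) = (μ : ℂ) ^ (4 * k) by norm_cast, mul_div_cancel₀ _ hk]
  · have d1 := hasDerivAt_psiMap_lambdaMap h0 hR hb hb1
    have d2 := (hφ.1.differentiableAt (hopen.mem_nhds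
      (mem_domainG h0 h1 hR ht₀))).hasDerivAt
    have d3 := d2.comp t₀ d1
    rw [← hval] at d3
    have d4 := d3.comp ((μ : ℂ) ^ (4 * k) * t₀)
      ((hasDerivAt_id ((μ : ℂ) ^ (4 * k) * t₀)).div_const ((μ : ℂ) ^ (4 * k)))
    rw [hval] at d4
    refine d4.congr_deriv ?_
    have e : ∀ A B C : ℂ, A * -(B / (μ * C)) * (1 / (μ : ℂ) ^ (4 * k)) =
        -(A * B / ((μ : ℂ) ^ (4 * k + 1) * C)) := by
      intro A B C
      simp only [div_eq_mul_inv, mul_inv, pow_succ]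
      ring
    have := e (deriv φ (psiMap R (lambdaMap μ t₀))) ((1 - (μ : ℂ) ^ 4) ^ 2 * (t₀ - (μ : ℂ) ^ 2 / t₀))
      (t₀ * (1 - (μ : ℂ) * t₀) ^ 2 * (1 - (μ : ℂ) ^ 3 / t₀) ^ 2)
    simp only [← mul_assoc] at this ⊢
    exact this

end
end IsAnnulusExtension

/-- The pseudo-hyperbolic distance to `μ` decreases along the segment towards the origin. -/
lemma norm_lambdaMap_mul_lt {μ : ℝ} (h0 : 0 < μ) {t : ℂ} (ht : ‖t‖ < 1) {s : ℝ}
    (hs0 : 0 < s) (hs1 : s < 1) (hd : μ < ‖lambdaMap μ t‖) (hd1 : ‖lambdaMap μ t‖ < 1) :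
    ‖lambdaMap μ (s * t)‖ < ‖lambdaMap μ t‖ := by
  set d := ‖lambdaMap μ t‖ with hdd
  have h1 : μ < 1 := hd.trans hd1
  have hm : (μ : ℂ) * t - 1 ≠ 0 := mul_sub_one_ne_zero h0 (by nlinarith [norm_nonneg t])
  have hms : (μ : ℂ) * (s * t) - 1 ≠ 0 := by
    refine mul_sub_one_ne_zero h0 ?_
    rw [norm_mul, Complex.norm_real, Real.norm_eq_abs, abs_of_pos hs0]
    have : s * ‖t‖ < 1 := by nlinarith [norm_nonneg t]
    nlinarith [mul_nonneg hs0.le (norm_nonneg t)]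
  have e1 : ‖t - μ‖ ^ 2 = d ^ 2 * ‖(μ : ℂ) * t - 1‖ ^ 2 := by
    rw [hdd, ← mul_pow, lambdaMap, norm_div, div_mul_cancel₀ _ (norm_ne_zero_iff.2 hm)]
  rw [lambdaMap, norm_div, div_lt_iff₀ (norm_pos_iff.2 hms),
    ← sq_lt_sq₀ (norm_nonneg _) (by positivity), mul_pow]
  -- Along the ray through t the comparison is a real quadratic in r with leading coefficient A ≥ 0
  -- and constant term C = μ² - d² < 0. It vanishes at r = 1, so it factors as (1 - r)(C - A r),
  -- negative for 0 < r < 1.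
  have e2 : ∀ r : ℝ, ‖(r : ℂ) * t - μ‖ ^ 2 - d ^ 2 * ‖(μ : ℂ) * (r * t) - 1‖ ^ 2 =
      (1 - d ^ 2 * μ ^ 2) * ‖t‖ ^ 2 * r ^ 2 - 2 * r * μ * (1 - d ^ 2) * t.re + (μ ^ 2 - d ^ 2) := by
    intro r
    simp only [Complex.sq_norm, Complex.normSq_apply, Complex.sub_re, Complex.sub_im,
      Complex.mul_re, Complex.mul_im, Complex.ofReal_re, Complex.ofReal_im, Complex.one_re,
      Complex.one_im]
    ring
  have e3 := e2 1
  rw [Complex.ofReal_one, one_mul, e1, sub_self] at e3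
  have e4 := e2 s
  have hA : 0 ≤ (1 - d ^ 2 * μ ^ 2) * ‖t‖ ^ 2 := by
    have : d ^ 2 * μ ^ 2 ≤ 1 := by
      rw [← mul_pow]
      refine pow_le_one₀ (by positivity) (by nlinarith)
    exact mul_nonneg (by linarith) (sq_nonneg _)
  have hC : μ ^ 2 - d ^ 2 < 0 := by nlinarith
  set A := (1 - d ^ 2 * μ ^ 2) * ‖t‖ ^ 2
  set C := μ ^ 2 - d ^ 2
  have e5 : ‖(s : ℂ) * t - μ‖ ^ 2 - d ^ 2 * ‖(μ : ℂ) * (s * t) - 1‖ ^ 2 = (1 - s) * (C - A * s) := by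
    rw [e4]
    linear_combination -s * e3
  have e6 : (1 - s) * (C - A * s) < 0 :=
    mul_neg_of_pos_of_neg (by linarith) (by nlinarith [mul_nonneg hA hs0.le])
  linarith

end

/-! ### Descent to the z-plane, univalence, and the singularities of h. -/

section
open Set Metric Filter

/-- A root of modulus at least one of the Joukowski equation. -/
noncomputable def joukRoot (z : ℂ) : ℂ := (exists_add_one_div_eq z).choose

lemma one_le_norm_joukRoot (z : ℂ) : 1 ≤ ‖joukRoot z‖ := (exists_add_one_div_eq z).choose_spec.1

lemma joukRoot_add (z : ℂ) : joukRoot z + 1 / joukRoot z = z :=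
  (exists_add_one_div_eq z).choose_spec.2

/-- The function on the `z`-plane induced by `H`. -/
noncomputable def descend (R μ : ℝ) (H : ℂ → OnePoint ℂ) (z : ℂ) : OnePoint ℂ :=
  H (lambdaMap μ ((joukRoot z + 1) / R))

lemma analyticAt_lambdaMap {μ : ℝ} {w : ℂ} (hw : (μ : ℂ) * w - 1 ≠ 0) :
    AnalyticAt ℂ (lambdaMap μ) w := by
  unfold lambdaMap
  fun_prop (disch := assumption)

lemma eventually_lambdaMap_ne {μ : ℝ} (h0 : 0 < μ) (h1 : μ < 1) {w : ℂ}
    (hw : (μ : ℂ) * w - 1 ≠ 0) : ∀ᶠ v in 𝓝[≠] w, lambdaMap μ v ≠ lambdaMap μ w := by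
  have hc : ContinuousAt (fun v : ℂ => (μ : ℂ) * v - 1) w := by fun_prop
  filter_upwards [(hc.eventually_ne hw).filter_mono nhdsWithin_le_nhds, self_mem_nhdsWithin]
    with v hv hvw h
  exact hvw (lambdaMap_injective h0 h1 hv hw h)

namespace IsAnnulusExtension

variable {R μ : ℝ} {φ : ℂ → ℂ} {H : ℂ → OnePoint ℂ} (hH : IsAnnulusExtension R μ φ H)
  (h0 : 0 < μ) (h1 : μ < 1) (hR : R * μ = μ ^ 2 + 1)
  (hφ : ConformalOnto φ (domainG R) (ball 0 1))
include hH h0 h1 hR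

/-- Whatever root `joukRoot` selects, it leads back to t or μ²/t, and H agrees at the two. -/
lemma descend_psiMap {t : ℂ} (ht : μ ^ 3 < ‖t‖) (ht1 : μ * ‖t‖ < 1) :
    descend R μ H (psiMap R (lambdaMap μ t)) = H t := by
  have ht0 : t ≠ 0 := norm_pos_iff.1 (lt_trans (by positivity) ht)
  have hRc : (R : ℂ) ≠ 0 := by
    have : R ≠ 0 := by linarith [two_lt_of_mul_eq h0 hR h1]
    exact_mod_cast this
  set z := psiMap R (lambdaMap μ t)
  have hu0 : joukRoot z ≠ 0 := norm_pos_iff.1 (by linarith [one_le_norm_joukRoot z])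
  obtain ⟨s, hs, -, h⟩ := eq_joukParam_of_add_one_div_eq h0 hR hu0 ht ht1 (joukRoot_add z)
  rw [descend, h, mul_div_cancel_left₀ _ hRc]
  rcases hs with rfl | rfl
  · rw [lambdaMap_lambdaMap h0 h1 (mul_sub_one_ne_zero h0 ht1)]
  · rw [lambdaMap_lambdaMap h0 h1 (mul_sub_one_ne_zero h0 (sq_div_bounds h0 ht ht1).2),
      hH.sq_div t ht0]

lemma descend_eq {z : ℂ} (hz : z ∈ domainG R) : descend R μ H z = φ z := by
  rw [domainG_eq h0 h1 hR] at hz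
  obtain ⟨t, ht, rfl⟩ := hz
  obtain ⟨hb, hb1⟩ := annulus_bounds h0 h1 ht.1.le ht.2.le
  dsimp only
  rw [hH.descend_psiMap h0 h1 hR hb hb1, hH.eq_coe t ht]

lemma descend_psiMap_of_bounds {w : ℂ} (hw : rhoNum R < ‖w‖) (hw1 : ‖w‖ < 1 / rhoNum R) :
    descend R μ H (psiMap R w) = H (lambdaMap μ w) := by
  have hR2 := two_lt_of_mul_eq h0 hR h1
  have hRp : 0 < R := by linarith
  rw [rhoNum, div_lt_iff₀ hRp] at hw
  rw [rhoNum, one_div_div] at hw1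
  have hn : ‖(R : ℂ) * w‖ = R * ‖w‖ := by
    rw [norm_mul, Complex.norm_real, Real.norm_eq_abs, abs_of_pos hRp]
  have hu : 1 < ‖(R : ℂ) * w - 1‖ := one_lt_norm_of_two_lt (by
    rw [sub_add_cancel, hn]
    linarith)
  obtain ⟨t, ht, ht1, hl, hj⟩ := exists_annulus_of_norm_lt h0 h1 hR hu.le (by
    rw [sub_add_cancel, hn]
    nlinarith)
  have hRc : (R : ℂ) ≠ 0 := by exact_mod_cast hRp.ne'
  have hwt : lambdaMap μ t = w := by
    rw [sub_add_cancel] at hl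
    exact mul_left_cancel₀ hRc hl
  have hb : μ ^ 3 < ‖t‖ := by
    nlinarith [pow_lt_one₀ h0.le h1 (two_ne_zero)]
  rw [← hwt, hH.descend_psiMap h0 h1 hR hb ht1,
    lambdaMap_lambdaMap h0 h1 (mul_sub_one_ne_zero h0 ht1)]

omit hR in
lemma sphereMeromorphicOn_comp_lambdaMap :
    SphereMeromorphicOn (fun w => H (lambdaMap μ w)) {(μ : ℂ), 1 / (μ : ℂ)}ᶜ := by
  intro w hw
  have hμ : (μ : ℂ) ≠ 0 := by exact_mod_cast h0.ne'
  simp only [mem_compl_iff, mem_insert_iff, mem_singleton_iff, not_or] at hw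
  have hw2 : (μ : ℂ) * w - 1 ≠ 0 := fun h => hw.2 (by
    rw [eq_div_iff hμ, mul_comm]
    exact sub_eq_zero.1 h)
  have hl : lambdaMap μ w ≠ 0 := div_ne_zero (sub_ne_zero.2 hw.1) hw2
  exact (hH.meromorphic _ hl).comp (analyticAt_lambdaMap hw2) (eventually_lambdaMap_ne h0 h1 hw2)

include hφ

/-- `joukRoot` need not be continuous. On G₁, which contains the branch values, the function is φ.
Elsewhere z comes from some t with μ < |t| < 1/μ, where ψ ∘ λ is injective and has an analytic
inverse. -/
lemma sphereMeromorphicOn_descend :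
    SphereMeromorphicOn (descend R μ H) (levelG R (1 / rhoNum R)) := by
  intro z hz
  have hopen : IsOpen (domainG R) := by
    rw [domainG_eq h0 h1 hR]
    exact isOpen_coveredDomain h0 h1 hR
  by_cases hzG : z ∈ domainG R
  · refine (hφ.1.analyticAt (hopen.mem_nhds hzG)).sphereMeromorphicAt.congr ?_
    filter_upwards [hopen.mem_nhds hzG] with w hw using (hH.descend_eq h0 h1 hR hw).symm
  obtain ⟨t, ht, ht1, rfl⟩ := exists_of_mem_levelG h0 h1 hR hz
  have htμ : μ < ‖t‖ := by
    by_contra! h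
    refine hzG ?_
    exact mem_domainG h0 h1 hR ⟨by nlinarith, by linarith⟩
  set V : Set ℂ := {t | ‖t‖ ∈ Ioi μ ∩ {r | μ * r < 1}} with hV
  have hVo : IsOpen V :=
    (isOpen_Ioi.inter (isOpen_lt (by fun_prop) (by fun_prop))).preimage continuous_norm
  have hcube : ∀ s ∈ V, μ ^ 3 < ‖s‖ := fun s hs => by
    have : μ < ‖s‖ := hs.1
    nlinarith [pow_lt_one₀ h0.le h1 (two_ne_zero)]
  have hVi : InjOn (fun t => psiMap R (lambdaMap μ t)) V := by
    intro s hs r hr h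
    refine ((psiMap_lambdaMap_eq_iff h0 h1 hR (hcube s hs) hs.2 (hcube r hr) hr.2).1
      h).resolve_right fun h2 => ?_
    have h3 : μ < ‖s‖ := hs.1
    have h4 : μ < ‖r‖ := hr.1
    rw [h2, norm_div, norm_pow, Complex.norm_real, Real.norm_eq_abs, abs_of_pos h0,
      lt_div_iff₀ (h0.trans h4)] at h3
    nlinarith
  have hVd : DifferentiableOn ℂ (fun t => psiMap R (lambdaMap μ t)) V := fun s hs =>
    (hasDerivAt_psiMap_lambdaMap h0 hR (hcube s hs)
      hs.2).differentiableAt.differentiableWithinAt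
  have htV : t ∈ V := ⟨htμ, ht1⟩
  have himg := hVi.nhds_le_map hVo hVd htV (image_mem_map (hVo.mem_nhds htV))
  have hleft := hVi.leftInvOn_invFunOn
  have ht0 : t ≠ 0 := norm_pos_iff.1 (h0.trans htμ)
  refine SphereMeromorphicAt.congr (f := fun z => H (Function.invFunOn
    (fun t => psiMap R (lambdaMap μ t)) V z)) ?_ ?_
  · refine SphereMeromorphicAt.comp ?_ (hVi.analyticAt_invFunOn hVo hVd htV) ?_
    · have := hleft htV
      dsimp only at this
      rw [this]
      exact hH.meromorphic t ht0
    · filter_upwards [nhdsWithin_le_nhds himg, self_mem_nhdsWithin] with y hy hyt h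
      obtain ⟨s, hs, rfl⟩ := hy
      have e1 := hleft hs
      have e2 := hleft htV
      dsimp only at e1 e2
      rw [e1, e2] at h
      exact hyt (by rw [h]; rfl)
  · filter_upwards [himg] with y hy
    obtain ⟨s, hs, rfl⟩ := hy
    have e1 := hleft hs
    dsimp only at e1 ⊢
    rw [e1, hH.descend_psiMap h0 h1 hR (hcube s hs) hs.2]

/-- Injectivity on the unit circle, by the open mapping theorem. -/
lemma eq_of_norm_eq_one {s t : ℂ} (hs : ‖s‖ = 1) (ht : ‖t‖ = 1) (h : H s = H t) : s = t := by
  by_contra hne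
  obtain ⟨ζ, hζ, hsζ⟩ := hH.unimodular hs
  -- Openness of H at a point of the circle: near each such preimage r of ζ, all values close to ζ
  -- are attained.
  have hlocal : ∀ r : ℂ, ‖r‖ = 1 → H r = ζ → ∀ N ∈ 𝓝 r,
      ∀ᶠ ξ : ℂ in 𝓝 ζ, ∃ x ∈ N, H x = (ξ : OnePoint ℂ) := by
    intro r hr hrζ N hN
    have hr0 : r ≠ 0 := norm_pos_iff.1 (by rw [hr]; exact one_pos)
    obtain ⟨g, hg, hHg⟩ := (hH.meromorphic r hr0).exists_analyticAt hrζ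
    have hgr : g r = ζ := by
      have := hHg.self_of_nhds
      rw [hrζ, OnePoint.coe_eq_coe] at this
      exact this.symm
    have hmap : 𝓝 (g r) ≤ map g (𝓝 r) := by
      refine hg.eventually_constant_or_nhds_le_map_nhds.resolve_left fun hconst => ?_
      -- Local constancy is impossible: along the radius towards r the values have modulus strictly
      -- less than 1.
      have hc : Tendsto (fun x : ℝ => (x : ℂ) * r) (𝓝[<] 1) (𝓝 r) := by
        have : ContinuousAt (fun x : ℝ => (x : ℂ) * r) 1 := by fun_prop
        have h2 := this.tendsto.mono_left (nhdsWithin_le_nhds (s := Iio 1))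
        simpa using h2
      have e1 : ∀ᶠ x in 𝓝[<] (1 : ℝ), μ ^ 2 < x :=
        (eventually_gt_nhds (by nlinarith)).filter_mono inf_le_left
      obtain ⟨x, ⟨⟨hx1, hx2⟩, hx3⟩, hx4⟩ :=
        (((hc.eventually (hconst.and hHg)).and e1).and self_mem_nhdsWithin).exists
      have hx4 : x < 1 := hx4
      have hx0 : 0 < x := lt_trans (by positivity) hx3
      have hn : ‖(x : ℂ) * r‖ = x := by
        rw [norm_mul, Complex.norm_real, Real.norm_eq_abs, abs_of_pos hx0, hr, mul_one]
      obtain ⟨ξ, hξ, hξH⟩ := hH.exists_disc h0 h1 hR hφ (t := x * r)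
        (show ‖(x : ℂ) * r‖ ∈ Ioo (μ ^ 2) 1 by rw [hn]; exact ⟨hx3, hx4⟩)
      rw [hx2, hx1, hgr, OnePoint.coe_eq_coe] at hξH
      rw [← hξH, hζ] at hξ
      exact lt_irrefl _ hξ
    rw [hgr] at hmap
    filter_upwards [hmap (image_mem_map (inter_mem hN hHg))] with ξ hξ
    obtain ⟨x, ⟨hxN, hxH⟩, rfl⟩ := hξ
    exact ⟨x, hxN, hxH⟩
  obtain ⟨A, B, hA, hB, hsA, htB, hAB⟩ := t2_separation hne
  have hnear : ∀ r : ℂ, ‖r‖ = 1 → {x : ℂ | μ < ‖x‖ ∧ μ ^ 2 * ‖x‖ ≤ 1} ∈ 𝓝 r := by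
    intro r hr
    have c1 : ∀ᶠ x in 𝓝 r, μ < ‖x‖ :=
      (continuous_norm.tendsto r).eventually_const_lt (by rw [hr]; exact h1)
    have c2 : ∀ᶠ x in 𝓝 r, μ ^ 2 * ‖x‖ < 1 :=
      ((continuous_norm.tendsto r).const_mul (μ ^ 2)).eventually_lt_const (by rw [hr]; nlinarith)
    filter_upwards [c1, c2] with x hx1 hx2 using ⟨hx1, hx2.le⟩
  have e1 := hlocal s hs hsζ _ (inter_mem (hA.mem_nhds hsA) (hnear s hs))
  have e2 := hlocal t ht (h ▸ hsζ) _ (inter_mem (hB.mem_nhds htB) (hnear t ht))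
  have hcl : ζ ∈ closure (ball (0 : ℂ) 1) := by
    rw [closure_ball _ one_ne_zero]
    simp [hζ]
  -- A value ξ inside the disc and close to ζ is attained at x near s and at y near t. Both satisfy
  -- μ < |·| < 1, so the alternative x = μ²/y is excluded and x = y, contradicting disjointness.
  obtain ⟨ξ, ⟨⟨x, ⟨hxA, hx1, hx2⟩, hxH⟩, ⟨y, ⟨hyB, hy1, hy2⟩, hyH⟩⟩, hξ⟩ :=
    mem_closure_iff_nhds.1 hcl _ (e1.and e2)
  rw [mem_ball_zero_iff] at hξ
  have hxA' : x ∈ openAnnulus μ :=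
    ⟨by nlinarith, hH.norm_lt_one_of_eq h0 h1 hR hφ hx2 hξ hxH⟩
  have hyA' : y ∈ openAnnulus μ :=
    ⟨by nlinarith, hH.norm_lt_one_of_eq h0 h1 hR hφ hy2 hξ hyH⟩
  rcases (hH.eq_iff_of_mem h0 h1 hR hφ hxA' hyA').1 (hxH.trans hyH.symm) with h3 | h3
  · exact disjoint_left.1 hAB hxA (h3 ▸ hyB)
  · rw [h3, norm_div, norm_pow, Complex.norm_real, Real.norm_eq_abs, abs_of_pos h0,
      lt_div_iff₀ (h0.trans hy1)] at hx1
    nlinarith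

/-- Parameters can be taken with μ ≤ |t| < 1/μ. Those inside the unit circle are separated by
univalence of φ, those on it by `eq_of_norm_eq_one`, and those outside by reflecting to 1/conj t,
which has modulus between μ and 1. Values from different regions never coincide. -/
lemma injOn_descend : InjOn (descend R μ H) (levelG R (1 / rhoNum R)) := by
  intro z hz w hw h
  obtain ⟨s, hs, hs1, rfl⟩ := exists_of_mem_levelG h0 h1 hR hz
  obtain ⟨t, ht, ht1, rfl⟩ := exists_of_mem_levelG h0 h1 hR hw
  have hcube : ∀ r : ℝ, μ ≤ r → μ ^ 3 < r := fun r hr => by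
    nlinarith [pow_lt_one₀ h0.le h1 (two_ne_zero)]
  have hsq : ∀ r : ℝ, μ ≤ r → μ ^ 2 < r := fun r hr => by nlinarith
  have hsq1 : ∀ r : ℝ, μ ≤ r → μ * r < 1 → μ ^ 2 * r < 1 := fun r hr hr1 => by nlinarith
  rw [hH.descend_psiMap h0 h1 hR (hcube _ hs) hs1, hH.descend_psiMap h0 h1 hR (hcube _ ht) ht1] at h
  have key : ∀ s t : ℂ, μ ≤ ‖s‖ → μ * ‖s‖ < 1 → μ ≤ ‖t‖ → μ * ‖t‖ < 1 → H s = H t →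
      ‖t‖ < 1 → ‖s‖ < 1 := by
    intro s t hs hs1 ht ht1 h htl
    obtain ⟨ζ, hζ, hζH⟩ := hH.exists_disc h0 h1 hR hφ (t := t) ⟨hsq _ ht, htl⟩
    exact hH.norm_lt_one_of_eq h0 h1 hR hφ (hsq1 _ hs hs1).le hζ (h.trans hζH)
  rcases lt_or_ge ‖t‖ 1 with htl | htl
  · have hsl := key s t hs hs1 ht ht1 h htl
    rw [hH.eq_coe s ⟨hsq _ hs, hsl⟩, hH.eq_coe t ⟨hsq _ ht, htl⟩, OnePoint.coe_eq_coe] at h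
    exact hφ.2.injOn (mem_domainG h0 h1 hR ⟨hsq _ hs, hsl⟩)
      (mem_domainG h0 h1 hR ⟨hsq _ ht, htl⟩) h
  have hsl : 1 ≤ ‖s‖ := by
    by_contra! h2
    exact absurd (key t s ht ht1 hs hs1 h.symm h2) (not_lt.2 htl)
  have hrefl : ∀ r : ℂ, 1 < ‖r‖ → μ * ‖r‖ < 1 →
      (conj r)⁻¹ ∈ openAnnulus μ ∧ μ < ‖(conj r)⁻¹‖ ∧ H (conj r)⁻¹ = sphereReflect (H r) := by
    intro r hr hr1
    refine ⟨norm_conj_inv_mem h0 h1 hr (hsq1 _ (by linarith) hr1), ?_,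
      hH.conj_inv r (norm_pos_iff.1 (by linarith))⟩
    rw [norm_inv, RCLike.norm_conj, ← one_div, lt_div_iff₀ (by linarith)]
    exact hr1
  have hout : ∀ s t : ℂ, ‖s‖ = 1 → 1 < ‖t‖ → μ * ‖t‖ < 1 → H s ≠ H t := by
    intro s t hs ht ht1 h
    obtain ⟨ζ, hζ, hζH⟩ := hH.unimodular hs
    obtain ⟨ξ, hξ, hξH⟩ := hH.exists_reflect h0 h1 hR hφ ht (hsq1 _ (by linarith) ht1)
    have := sphereReflect_coe_eq_coe ((hξH.symm.trans h.symm).trans hζH)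
    rw [hζ, one_mul] at this
    linarith
  rcases htl.eq_or_lt with htl | htl <;> rcases hsl.eq_or_lt with hsl | hsl
  · rw [hH.eq_of_norm_eq_one h0 h1 hR hφ hsl.symm htl.symm h]
  · exact absurd h.symm (hout t s htl.symm hsl hs1)
  · exact absurd h (hout s t hsl.symm htl ht1)
  · obtain ⟨a1, a2, a3⟩ := hrefl s hsl hs1
    obtain ⟨b1, b2, b3⟩ := hrefl t htl ht1
    rcases (hH.eq_iff_of_mem h0 h1 hR hφ a1 b1).1 (by rw [a3, b3, h]) with h2 | h2
    · have h3 := congrArg conj (inv_injective h2)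
      rw [Complex.conj_conj, Complex.conj_conj] at h3
      rw [h3]
    · rw [h2, norm_div, norm_pow, Complex.norm_real, Real.norm_eq_abs, abs_of_pos h0,
        lt_div_iff₀ (h0.trans b2)] at a2
      nlinarith

/-- λ sends 0 to μ and ∞ to 1/μ. Small preimages of c exist by the period μ⁴, and t ↦ μ²/t turns
them into large ones. -/
lemma exists_mem_nhds {a : ℂ} (ha : a = μ ∨ a = 1 / μ) {U : Set ℂ} (hU : U ∈ 𝓝 a)
    (c : OnePoint ℂ) : ∃ w ∈ U \ {(μ : ℂ), 1 / (μ : ℂ)}, H (lambdaMap μ w) = c := by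
  have hμ : (μ : ℂ) ≠ 0 := by exact_mod_cast h0.ne'
  have hmem : ∀ t : ℂ, t ≠ 0 → (μ : ℂ) * t - 1 ≠ 0 →
      lambdaMap μ t ∉ ({(μ : ℂ), 1 / (μ : ℂ)} : Set ℂ) := by
    intro t ht ht1 h
    have h2 := lambdaMap_lambdaMap h0 h1 ht1
    rcases h with h | h
    · rw [h] at h2
      simp [lambdaMap] at h2
      exact ht h2.symm
    · rw [mem_singleton_iff] at h
      exact mul_lambdaMap_sub_one_ne_zero h0 h1 ht1 (by rw [h, mul_one_div_cancel hμ, sub_self])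
  rcases ha with rfl | rfl
  · have hc : ContinuousAt (lambdaMap μ) 0 := (analyticAt_lambdaMap (by simp)).continuousAt
    have hv : lambdaMap μ 0 = μ := by simp [lambdaMap]
    rw [← hv] at hU
    obtain ⟨ε, hε, hball⟩ := Metric.mem_nhds_iff.1 (hc hU)
    obtain ⟨t, ht0, htε, htc⟩ := hH.exists_small h0 h1 hR hφ c (ε := min ε 1) (by positivity)
    have ht1 : (μ : ℂ) * t - 1 ≠ 0 := mul_sub_one_ne_zero h0 (by
      have := htε.trans_le (min_le_right _ _)
      nlinarith [norm_nonneg t])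
    refine ⟨lambdaMap μ t, ⟨hball (mem_ball_zero_iff.2 (htε.trans_le (min_le_left _ _))),
      hmem t ht0 ht1⟩, ?_⟩
    rw [lambdaMap_lambdaMap h0 h1 ht1, htc]
  · have hc : ContinuousAt (fun s : ℂ => (1 - μ * s) / (μ - s)) 0 := by
      refine ContinuousAt.div (by fun_prop) (by fun_prop) ?_
      simpa using hμ
    have hv : (fun s : ℂ => (1 - μ * s) / (μ - s)) 0 = 1 / μ := by simp
    rw [← hv] at hU
    obtain ⟨ε, hε, hball⟩ := Metric.mem_nhds_iff.1 (hc hU)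
    -- Here s = t/μ² is the reciprocal of μ²/t. The factor μ² in the radius gives |s| < min ε μ,
    -- which keeps s away from the zero μ of the denominator in λ(1/s) = (1 - μs)/(μ - s).
    obtain ⟨t, ht0, htε, htc⟩ := hH.exists_small h0 h1 hR hφ c
      (ε := μ ^ 2 * min ε μ) (by positivity)
    have hs0 : t / (μ : ℂ) ^ 2 ≠ 0 := div_ne_zero ht0 (pow_ne_zero 2 hμ)
    have hsn : ‖t / (μ : ℂ) ^ 2‖ < min ε μ := by
      rw [norm_div, norm_pow, Complex.norm_real, Real.norm_eq_abs, abs_of_pos h0,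
        div_lt_iff₀ (by positivity), mul_comm]
      exact htε
    set s : ℂ := t / (μ : ℂ) ^ 2 with hs
    have hsμ : (μ : ℂ) - s ≠ 0 := by
      intro h
      have := hsn.trans_le (min_le_right _ _)
      rw [← sub_eq_zero.1 h, Complex.norm_real, Real.norm_eq_abs, abs_of_pos h0] at this
      exact lt_irrefl _ this
    have ht1 : (μ : ℂ) * s⁻¹ - 1 ≠ 0 := by
      rw [← div_eq_mul_inv, div_sub_one hs0]
      exact div_ne_zero hsμ hs0
    have hl : lambdaMap μ s⁻¹ = (1 - μ * s) / (μ - s) := by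
      rw [lambdaMap, div_eq_div_iff ht1 hsμ]
      field_simp
    refine ⟨lambdaMap μ s⁻¹, ⟨?_, hmem _ (inv_ne_zero hs0) ht1⟩, ?_⟩
    · rw [hl]
      exact hball (mem_ball_zero_iff.2 (hsn.trans_le (min_le_left _ _)))
    · rw [lambdaMap_lambdaMap h0 h1 ht1, ← htc, ← hH.sq_div t ht0]
      congr 1
      rw [hs, inv_div]

end IsAnnulusExtension

end

theorem proposition3 (R : ℝ) (hR : 2 < R) (μ : ℝ) (hμ : μ = muNum R)
    (φ : ℂ → ℂ) (hφ : ConformalOnto φ (domainG R) (Metric.ball 0 1)) :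
    -- `φext` continues `φ` to `G_{1/ρ}`, `h` is `h_φ`, and `H` is `h_φ ∘ λ`
    ∃ φext h H : ℂ → OnePoint ℂ,
      -- the meromorphic univalent continuation of `φ` through which `φ ∘ ψ` is defined
      -- on `ρ < |w| < 1 / ρ`
      (SphereMeromorphicOn φext (levelG R (1 / rhoNum R)) ∧
        Set.InjOn φext (levelG R (1 / rhoNum R)) ∧
        domainG R ⊆ levelG R (1 / rhoNum R) ∧
        (∀ z ∈ domainG R, φext z = (φ z : OnePoint ℂ)) ∧
        ∀ w : ℂ, rhoNum R < ‖w‖ → ‖w‖ < 1 / rhoNum R →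
          psiMap R w ∈ levelG R (1 / rhoNum R)) ∧
      -- (a)
      (SphereMeromorphicOn h {(μ : ℂ), 1 / (μ : ℂ)}ᶜ ∧
        (∀ w : ℂ, rhoNum R < ‖w‖ → ‖w‖ < 1 / rhoNum R → h w = φext (psiMap R w)) ∧
        ∀ a ∈ ({(μ : ℂ), 1 / (μ : ℂ)} : Set ℂ), ∀ U ∈ 𝓝 a, ∀ c : OnePoint ℂ,
          ∃ w ∈ U \ {(μ : ℂ), 1 / (μ : ℂ)}, h w = c) ∧
      -- (b); note that `λ` has its pole at `1 / μ`
      ((∀ t : ℂ, t ≠ 0 → t ≠ 1 / (μ : ℂ) → H t = h (lambdaMap μ t)) ∧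
        SphereMeromorphicOn H {0}ᶜ ∧
        ∀ k : ℤ, k ≠ 0 → ∀ t : ℂ, μ ^ (2 * k + 2) ≤ ‖t‖ → ‖t‖ ≤ μ ^ (2 * k) →
          (Odd k → H t = sphereReflect (H (conj t / (μ : ℂ) ^ (2 * k)))) ∧
          (Even k → H t = H (t / (μ : ℂ) ^ (2 * k)))) ∧
      -- (c)
      ∀ t₀ : ℂ, μ ^ 2 < ‖t₀‖ → ‖t₀‖ < 1 →
        {t : ℂ | 0 < ‖t‖ ∧ ‖t‖ < 1 ∧ H t = H t₀} =
            Set.range (fun k : ℕ => (μ : ℂ) ^ (4 * k) * t₀) ∪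
              Set.range (fun k : ℕ => (μ : ℂ) ^ (4 * k + 2) / t₀) ∧
        (∀ k : ℕ, SphereHasDerivAt H
          (-(deriv φ (psiMap R (lambdaMap μ t₀)) * (1 - (μ : ℂ) ^ 4) ^ 2 *
                (t₀ - (μ : ℂ) ^ 2 / t₀) /
              ((μ : ℂ) ^ (4 * k + 1) * t₀ * (1 - (μ : ℂ) * t₀) ^ 2 *
                (1 - (μ : ℂ) ^ 3 / t₀) ^ 2)))
          ((μ : ℂ) ^ (4 * k) * t₀)) ∧
        (μ < ‖lambdaMap μ t₀‖ → ‖lambdaMap μ t₀‖ < 1 →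
          ∀ k : ℕ, 1 ≤ k → ‖lambdaMap μ ((μ : ℂ) ^ (4 * k) * t₀)‖ < ‖lambdaMap μ t₀‖) := by
  subst hμ
  obtain ⟨h0, h1, hRμ⟩ := muNum_spec hR
  set μ := muNum R with hμdef
  have hμ : (μ : ℂ) ≠ 0 := by exact_mod_cast h0.ne'
  obtain ⟨H, hH⟩ := exists_isAnnulusExtension h0 h1 hRμ hφ
  -- As λ is its own inverse, h = H ∘ λ is the function for which H = h ∘ λ off the pole; at the
  -- pole 1/μ, H itself supplies the continuous extension.
  refine ⟨descend R μ H, fun w => H (lambdaMap μ w), H,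
    ⟨hH.sphereMeromorphicOn_descend h0 h1 hRμ hφ, hH.injOn_descend h0 h1 hRμ hφ,
      domainG_subset_levelG h0 h1 hRμ, fun z hz => hH.descend_eq h0 h1 hRμ hz,
      fun w hw hw1 => psiMap_mem_levelG h0 h1 hRμ hw hw1⟩,
    ⟨hH.sphereMeromorphicOn_comp_lambdaMap h0 h1,
      fun w hw hw1 => (hH.descend_psiMap_of_bounds h0 h1 hRμ hw hw1).symm,
      fun a ha U hU c => hH.exists_mem_nhds h0 h1 hRμ hφ ha hU c⟩,
    ⟨fun t _ ht1 => ?_, fun t ht => hH.meromorphic t ht, fun k _ t ht _ => ?_⟩,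
    fun t₀ ht ht1 => ⟨hH.solutions h0 h1 hRμ hφ ⟨ht, ht1⟩,
      fun k => hH.hasDerivAt h0 h1 hRμ hφ ⟨ht, ht1⟩ k, fun hd hd1 k hk => ?_⟩⟩
  · dsimp only
    rw [lambdaMap_lambdaMap h0 h1 fun h => ht1 ?_]
    rw [eq_div_iff hμ, mul_comm]
    exact sub_eq_zero.1 h
  · have ht0 : t ≠ 0 := norm_pos_iff.1 ((zpow_pos h0 _).trans_le ht)
    exact ⟨fun hk => hH.eq_of_odd h0 ht0 hk, fun hk => hH.eq_of_even h0 ht0 hk⟩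
  · have := norm_lambdaMap_mul_lt h0 ht1 (pow_pos h0 (4 * k))
      (pow_lt_one₀ h0.le h1 (by omega)) hd hd1
    rwa [Complex.ofReal_pow] at this
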